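/- **Setting.** Let $M$ be a compact metrizable space and let $\Gamma\subset\mathrm{Homeo}(M)$ be a countable subgroup which is a convergence group: for every sequence $(\gamma_n)$ of pairwise distinct elements of $\Gamma$ there are $a,b\in M$ and a subsequence $(\gamma_{n_k})$ such that $\gamma_{n_k}|_{M\setminus\{b\}}$ converges locally uniformly to the constant $a$. The limit set $\Lambda(\Gamma)$ is the set of $x\in M$ for which there are $y\in M$ and a sequence $(\gamma_n)$ in $\Gamma$ such that $\gamma_n|_{M\setminus\{y\}}$ converges locally uniformly to $x$. Assume that $\Gamma$ is non-elementary, i.e. $\#\Lambda(\Gamma)\ge 3$. An element $\gamma\in\Gamma$ is loxodromic if it has two distinct fixed points $\gamma^+,\gamma^-\in\Lambda(\Gamma)$ such that $(\gamma^{\pm1})^n|_{M\setminus\{\gamma^\mp\}}$ converges locally uniformly to $\gamma^\pm$. Give $\Gamma\sqcup M$ the topology in which $U$ is open iff $U\cap M$ is open in $M$ and, whenever $(\gamma_n)$ is a sequence of pairwise distinct elements of $\Gamma$ such that $\gamma_n|_{M\setminus\{b\}}$ converges locally uniformly to $a$ for some $b\in M$ and $a\in U\cap M$, one has $\gamma_n\in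 U$ for all large $n$. (This is the unique compact metrizable topology which induces the discrete topology on $\Gamma$ and the given one on $M$ and for which the natural action of $\Gamma$ is a convergence group action.) Fix a compatible metric $d$ on $\Gamma\sqcup M$, that is, a metric inducing this topology. A function $\sigma:\Gamma\times M\to\mathbb R$ is a coarse-cocycle if there is a $\kappa$ such that $\limsup_{x\to x_0}|\sigma(\gamma,x)-\sigma(\gamma,x_0)|\le\kappa$ and $|\sigma(\gamma_1\gamma_2,x)-(\sigma(\gamma_1,\gamma_2x)+\sigma(\gamma_2,x))|\le\kappa$ for all $\gamma,\gamma_1,\gamma_2\in\Gamma$ and $x,x_0\in M$. It is proper if $\sigma(\gamma_n,\gamma_n^+)\to\infty$ for every sequence of pairwise distinct loxodromic elements $\gamma_n$ with $\liminf_n d(\gamma_n^-,\gamma_n^+)>0$. It is expanding if it is proper and there is a function $\gamma\mapsto\|\gamma\|_\sigma\in\mathbb R$ on $\Gamma$, called a magnitude, such that for every $\epsilon>0$ there is $C>0$ with $|\sigma(\gamma,x)-\|\gamma\|_\sigma|\le C$ for all $x\in M$, $\gamma\in\Gamma$ with $d(x,\gamma^{-1})>\epsilon$. For each expanding coarse-cocycle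 an arbitrary magnitude is fixed. For $H\subset\Gamma$ let $\delta_\sigma(H)=\inf\{s>0:\sum_{\gamma\in H}e^{-s\|\gamma\|_\sigma}<\infty\}\in[0,\infty]$. For a finite set $S\subset\Gamma$ let $S^0=\{\mathrm{id}\}$ and let $S^m$ be the set of products of $m$ elements of $S$. For $\gamma\in\bigcup_{m\ge0}S^m$ let $|\gamma|_S=\min\{m\ge 0:\gamma\in S^m\}$, so that $|\mathrm{id}|_S=0$. **Theorem.** Let $\sigma$ be an expanding coarse-cocycle for $\Gamma$ and let $0<\delta<\delta_\sigma(\Gamma)$, with $\delta$ real. Then there is a finite set $S\subset\Gamma$ such that the semigroup $\mathcal T=\bigcup_{m\ge0}S^m$ is free on $S$ (two words in $S$, the empty word representing $\mathrm{id}$, that represent the same element of $\Gamma$ are equal) and has the following properties. 1. $\delta_\sigma(\mathcal T)\ge\delta$. 2. For every expanding coarse-cocycle $\phi:\Gamma\times M\to\mathbb R$ there are constants $B_1=B_1(\phi)>1$ and $b_1=b_1(\phi)>0$ such that $$\frac1{B_1}|\gamma|_S-b_1\le\|\gamma\|_\phi\le B_1|\gamma|_S+b_1\qquad\text{for all }\gamma\in\mathcal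 T.$$ 3. If $B_1>1$ and $b_1>0$ are constants as in (2) for $\phi=\sigma$, then $$\frac1{B_1}\log(\#S)\le\delta_\sigma(\mathcal T)\le B_1\log(\#S).$$ In particular $\delta_\sigma(\mathcal T)<\infty$. 4. $\delta_\sigma(\mathcal T)<\delta_\sigma(\Gamma)$. 5. For any two expanding coarse-cocycles $\phi_1,\phi_2:\Gamma\times M\to\mathbb R$ there are constants $B_2=B_2(\phi_1,\phi_2)>1$ and $b_2=b_2(\phi_1,\phi_2)>0$ such that $$\frac1{B_2}\|\gamma\|_{\phi_2}-b_2\le\|\gamma\|_{\phi_1}\le B_2\|\gamma\|_{\phi_2}+b_2\qquad\text{for all }\gamma\in\mathcal T.$$ -/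

import Mathlib

open Filter Topology Set

namespace BishopJones

variable {M : Type*} [MetricSpace M]

/-- The restriction of `γ n` to `M \ {b}` converges locally uniformly to the constant `a`. -/
def ConvergesOff (γ : ℕ → M ≃ₜ M) (a b : M) : Prop :=
  TendstoLocallyUniformlyOn (fun n x => γ n x) (fun _ => a) atTop {b}ᶜ

/-- (Discrete) convergence groups: countable groups of homeomorphisms of `M` for which every
sequence of pairwise distinct elements has a subsequence that converges locally uniformly to a
point on the complement of a point. -/
structure IsConvergenceGroup (Γ : Subgroup (M ≃ₜ M)) : Prop where
  countable : Countable Γ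
  exists_subseq : ∀ γ : ℕ → Γ, Function.Injective γ →
    ∃ a b : M, ∃ k : ℕ → ℕ, StrictMono k ∧ ConvergesOff (fun n => (γ (k n) : M ≃ₜ M)) a b

/-- The limit set `Λ(Γ)`. -/
def limitSet (Γ : Subgroup (M ≃ₜ M)) : Set M :=
  {x | ∃ y : M, ∃ γ : ℕ → Γ, ConvergesOff (fun n => (γ n : M ≃ₜ M)) x y}

/-- `Γ` is non-elementary: the limit set has at least three points. -/
def IsNonElementary (Γ : Subgroup (M ≃ₜ M)) : Prop :=
  3 ≤ (limitSet Γ).encard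

/-- `γ` is loxodromic with attracting fixed point `p = γ⁺` and repelling fixed point `q = γ⁻`. -/
structure IsLoxodromic (Γ : Subgroup (M ≃ₜ M)) (γ : Γ) (p q : M) : Prop where
  ne : p ≠ q
  mem_attracting : p ∈ limitSet Γ
  mem_repelling : q ∈ limitSet Γ
  fixed_attracting : (γ : M ≃ₜ M) p = p
  fixed_repelling : (γ : M ≃ₜ M) q = q
  tendsto_attracting : ConvergesOff (fun n => (γ : M ≃ₜ M) ^ n) p q
  tendsto_repelling : ConvergesOff (fun n => ((γ : M ≃ₜ M)⁻¹) ^ n) q p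

/-- The disjoint union `Γ ⊔ M`; a type of its own, so that it carries no topology by default. -/
def GroupUnion (Γ : Subgroup (M ≃ₜ M)) : Type _ := Γ ⊕ M

/-- The inclusion `Γ → Γ ⊔ M`. -/
def ofGroup {Γ : Subgroup (M ≃ₜ M)} (γ : Γ) : GroupUnion Γ := Sum.inl γ

/-- The inclusion `M → Γ ⊔ M`. -/
def ofSpace (Γ : Subgroup (M ≃ₜ M)) (x : M) : GroupUnion Γ := Sum.inr x

/-- The topology on `Γ ⊔ M`: a set `U` is open iff its trace on `M` is open and it eventually
contains every sequence of distinct elements of `Γ` which converges, locally uniformly off a point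
of `M`, to a point of `U ∩ M`. When `Γ` is a non-elementary convergence group, this is the unique
compact metrizable topology that restricts to the given topology on `M` and to the discrete one on
`Γ` and for which the natural action of `Γ` is a convergence group action. -/
abbrev unionTopology (Γ : Subgroup (M ≃ₜ M)) : TopologicalSpace (GroupUnion Γ) where
  IsOpen U := IsOpen (ofSpace Γ ⁻¹' U) ∧
    ∀ (γ : ℕ → Γ) (a b : M), Function.Injective γ →
      ConvergesOff (fun n => (γ n : M ≃ₜ M)) a b → ofSpace Γ a ∈ U →
      ∀ᶠ n in atTop, ofGroup (γ n) ∈ U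
  isOpen_univ := ⟨by simp, fun _ _ _ _ _ _ => by simp⟩
  isOpen_inter U V hU hV := ⟨hU.1.inter hV.1, fun γ a b hγ h ha =>
    (hU.2 γ a b hγ h ha.1).and (hV.2 γ a b hγ h ha.2)⟩
  isOpen_sUnion 𝒰 h𝒰 := by
    refine ⟨?_, fun γ a b hγ h ha => ?_⟩
    · rw [preimage_sUnion]
      exact isOpen_biUnion fun U hU => (h𝒰 U hU).1
    · obtain ⟨U, hU, haU⟩ := ha
      exact ((h𝒰 U hU).2 γ a b hγ h haU).mono fun n hn => ⟨U, hU, hn⟩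

/-- A compatible metric: a metric on `Γ ⊔ M` that induces the above topology. -/
def IsCompatible {Γ : Subgroup (M ≃ₜ M)} (d : MetricSpace (GroupUnion Γ)) : Prop :=
  d.toPseudoMetricSpace.toUniformSpace.toTopologicalSpace = unionTopology Γ

/-- `κ`-coarse-cocycles. The upper limit is taken in the extended reals. -/
structure IsCoarseCocycleWith {Γ : Subgroup (M ≃ₜ M)} (κ : ℝ) (σ : Γ → M → ℝ) : Prop where
  coarselyContinuous : ∀ (γ : Γ) (x₀ : M),
    limsup (fun x => ((|σ γ x - σ γ x₀| : ℝ) : EReal)) (𝓝 x₀) ≤ (κ : EReal)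
  cocycle : ∀ (γ₁ γ₂ : Γ) (x : M),
    |σ (γ₁ * γ₂) x - (σ γ₁ ((γ₂ : M ≃ₜ M) x) + σ γ₂ x)| ≤ κ

/-- Coarse-cocycles. -/
def IsCoarseCocycle {Γ : Subgroup (M ≃ₜ M)} (σ : Γ → M → ℝ) : Prop :=
  ∃ κ : ℝ, IsCoarseCocycleWith κ σ

/-- Properness with respect to a metric on `Γ ⊔ M`. -/
def IsProper {Γ : Subgroup (M ≃ₜ M)} (d : MetricSpace (GroupUnion Γ)) (σ : Γ → M → ℝ) : Prop :=
  ∀ (γ : ℕ → Γ) (p q : ℕ → M), Function.Injective γ →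
    (∀ n, IsLoxodromic Γ (γ n) (p n) (q n)) →
    0 < liminf (fun n => ((d.dist (ofSpace Γ (q n)) (ofSpace Γ (p n)) : ℝ) : EReal)) atTop →
    Tendsto (fun n => σ (γ n) (p n)) atTop atTop

/-- `mag` is a choice of a `σ`-magnitude `γ ↦ ‖γ‖_σ`. -/
def IsMagnitude {Γ : Subgroup (M ≃ₜ M)} (d : MetricSpace (GroupUnion Γ)) (σ : Γ → M → ℝ)
    (mag : Γ → ℝ) : Prop :=
  ∀ ε : ℝ, 0 < ε → ∃ C : ℝ, 0 < C ∧ ∀ (x : M) (γ : Γ),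
    ε < d.dist (ofSpace Γ x) (ofGroup γ⁻¹) → |σ γ x - mag γ| ≤ C

/-- `σ` is an expanding coarse-cocycle, and `mag` is a choice of its magnitude. -/
structure IsExpanding {Γ : Subgroup (M ≃ₜ M)} (d : MetricSpace (GroupUnion Γ)) (σ : Γ → M → ℝ)
    (mag : Γ → ℝ) : Prop where
  coarseCocycle : IsCoarseCocycle σ
  proper : IsProper d σ
  magnitude : IsMagnitude d σ mag

/-- The Poincaré series `∑_{γ ∈ H} e^{-s ‖γ‖}` of a subset `H`, with values in `[0, ∞]`. -/
noncomputable def poincareSeries {G : Type*} (mag : G → ℝ) (H : Set G) (s : ℝ) : ENNReal :=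
  ∑' γ : H, ENNReal.ofReal (Real.exp (-s * mag γ))

/-- The critical exponent `inf {s > 0 : ∑_{γ ∈ H} e^{-s ‖γ‖} < ∞}` of a subset `H`, with values in
`[0, ∞]`; it is `∞` when there is no such `s`. -/
noncomputable def criticalExponent {G : Type*} (mag : G → ℝ) (H : Set G) : ENNReal :=
  sInf {t | ∃ s : ℝ, 0 < s ∧ poincareSeries mag H s < ⊤ ∧ t = ENNReal.ofReal s}

/-- The word length `|γ|_S` of an element `γ` of the semigroup (with identity) generated by `S`:
the least length of a word in `S` that represents `γ`, so that the identity has length `0`. -/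
noncomputable def wordLength {G : Type*} [Group G] (S : Finset G) (γ : G) : ℕ :=
  sInf {k | ∃ w : List G, w.length = k ∧ (∀ g ∈ w, g ∈ S) ∧ w.prod = γ}

/-- The semigroup generated by `S`, which contains the identity, is free on `S`. -/
def IsFreeOn {G : Type*} [Group G] (S : Finset G) : Prop :=
  Function.Injective (FreeMonoid.lift (fun s : S => (s : G)))

/-- `(1/B) f - b ≤ g ≤ B f + b` on the set `H`. -/
def CoarselyBiLipschitzOn {G : Type*} (H : Set G) (B b : ℝ) (f g : G → ℝ) : Prop :=
  ∀ γ ∈ H, 1 / B * f γ - b ≤ g γ ∧ g γ ≤ B * f γ + b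

/-- The trace of a basic open set of `Γ ⊔ M`, for three auxiliary points `p i`. -/
def hat (Γ : Subgroup (M ≃ₜ M)) (p : Fin 3 → M) (A : Set M) : Set (GroupUnion Γ) :=
  {z | Sum.elim (fun γ : Γ => ∃ i j, i ≠ j ∧ (γ : M ≃ₜ M) (p i) ∈ A ∧ (γ : M ≃ₜ M) (p j) ∈ A)
    (fun x => x ∈ A) z}

lemma exists_pair {X : Type*} {p : Fin 3 → X} (hp : Function.Injective p) (b : X) :
    ∃ i j, i ≠ j ∧ p i ≠ b ∧ p j ≠ b := by
  by_cases h0 : p 0 = b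
  · exact ⟨1, 2, by decide, fun h => absurd (hp (h.trans h0.symm)) (by decide),
      fun h => absurd (hp (h.trans h0.symm)) (by decide)⟩
  · by_cases h1 : p 1 = b
    · exact ⟨0, 2, by decide, h0, fun h => absurd (hp (h.trans h1.symm)) (by decide)⟩
    · exact ⟨0, 1, by decide, h0, h1⟩

lemma common_index : ∀ i j k l : Fin 3, i ≠ j → k ≠ l → i = k ∨ i = l ∨ j = k ∨ j = l := by
  decide

lemma ofSpace_ne_ofGroup {Γ : Subgroup (M ≃ₜ M)} (x : M) (γ : Γ) : ofSpace Γ x ≠ ofGroup γ :=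
  Sum.inr_ne_inl

lemma isOpen_singleton_group (Γ : Subgroup (M ≃ₜ M)) (γ : Γ) :
    IsOpen[unionTopology Γ] {(ofGroup γ : GroupUnion Γ)} := by
  refine ⟨?_, fun _ a _ _ _ ha => ?_⟩
  · have : ofSpace Γ ⁻¹' {(ofGroup γ : GroupUnion Γ)} = ∅ := by
      ext x; simp [ofSpace_ne_ofGroup]
    rw [this]; exact isOpen_empty
  · exact absurd ha (ofSpace_ne_ofGroup a γ)

lemma isOpen_diff_finite (Γ : Subgroup (M ≃ₜ M)) {U : Set (GroupUnion Γ)}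
    (hU : IsOpen[unionTopology Γ] U) (F : Finset Γ) :
    IsOpen[unionTopology Γ] (U \ ofGroup '' (F : Set Γ)) := by
  refine ⟨?_, fun γ a b hγ h ha => ?_⟩
  · have : ofSpace Γ ⁻¹' (U \ ofGroup '' (F : Set Γ)) = ofSpace Γ ⁻¹' U := by
      ext x; simp [(ofSpace_ne_ofGroup x _).symm]
    rw [this]; exact hU.1
  · have h1 := hU.2 γ a b hγ h ha.1
    have h2 : ∀ᶠ n in atTop, γ n ∉ (F : Set Γ) := by
      have := hγ.tendsto_cofinite.eventually F.finite_toSet.eventually_cofinite_notMem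
      rwa [Nat.cofinite_eq_atTop] at this
    filter_upwards [h1, h2] with n hn hn'
    refine ⟨hn, ?_⟩
    rintro ⟨g, hg, hgn⟩
    exact hn' (Sum.inl_injective hgn ▸ hg)

lemma ConvergesOff.tendsto {γ : ℕ → M ≃ₜ M} {a b x : M} (h : ConvergesOff γ a b)
    (hx : x ≠ b) : Tendsto (fun n => γ n x) atTop (𝓝 a) :=
  TendstoLocallyUniformlyOn.tendsto_at h hx

lemma isOpen_hat (Γ : Subgroup (M ≃ₜ M)) {p : Fin 3 → M} (hp : Function.Injective p)
    {A : Set M} (hA : IsOpen A) : IsOpen[unionTopology Γ] (hat Γ p A) := by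
  refine ⟨hA, fun γ a b _ h ha => ?_⟩
  obtain ⟨i, j, hij, hi, hj⟩ := exists_pair hp b
  have ha' : A ∈ 𝓝 a := hA.mem_nhds ha
  filter_upwards [(h.tendsto hi) ha', (h.tendsto hj) ha'] with n h1 h2
  exact ⟨i, j, hij, h1, h2⟩

lemma disjoint_hat (Γ : Subgroup (M ≃ₜ M)) (p : Fin 3 → M) {A B : Set M}
    (h : Disjoint A B) : Disjoint (hat Γ p A) (hat Γ p B) := by
  rw [Set.disjoint_left] at h ⊢
  rintro (γ | x) h1 h2
  · obtain ⟨i, j, hij, hi, hj⟩ := h1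
    obtain ⟨k, l, hkl, hk, hl⟩ := h2
    rcases common_index i j k l hij hkl with rfl | rfl | rfl | rfl
    exacts [h hi hk, h hi hl, h hj hk, h hj hl]
  · exact h h1 h2

/-- If a set of group elements avoids an open set `U`, and each of its sequences of distinct
elements that converges does so to a point of `U`, then it is finite. -/
lemma finite_of_attractors {Γ : Subgroup (M ≃ₜ M)} (hΓ : IsConvergenceGroup Γ)
    {U : Set (GroupUnion Γ)} (hU : IsOpen[unionTopology Γ] U) (E : Set Γ)
    (hE : ∀ g ∈ E, ofGroup g ∉ U)
    (hlim : ∀ (γ : ℕ → Γ) (a b : M), (∀ n, γ n ∈ E) →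
      ConvergesOff (fun n => (γ n : M ≃ₜ M)) a b → ofSpace Γ a ∈ U) : E.Finite := by
  by_contra hinf
  have hinf : E.Infinite := hinf
  obtain ⟨a, b, k, hk, hc⟩ := hΓ.exists_subseq (fun n => (hinf.natEmbedding E n : Γ))
    (Subtype.val_injective.comp (hinf.natEmbedding E).injective)
  have hmem : ∀ n, (hinf.natEmbedding E (k n) : Γ) ∈ E := fun n => Subtype.coe_prop _
  have := hU.2 (fun n => (hinf.natEmbedding E (k n) : Γ)) a b
    (Subtype.val_injective.comp ((hinf.natEmbedding E).injective.comp hk.injective)) hc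
    (hlim _ a b hmem hc)
  obtain ⟨n, hn⟩ := this.exists
  exact hE _ (hmem n) hn

lemma compactSpace_union [CompactSpace M] {Γ : Subgroup (M ≃ₜ M)}
    (hΓ : IsConvergenceGroup Γ) : @CompactSpace (GroupUnion Γ) (unionTopology Γ) := by
  let _ := unionTopology Γ
  have hcont : Continuous (ofSpace Γ) := ⟨fun U hU => hU.1⟩
  refine ⟨isCompact_of_finite_subcover fun {ι} U hUo hsU => ?_⟩
  obtain ⟨t, ht⟩ := (isCompact_range hcont).elim_finite_subcover U hUo
    ((subset_univ _).trans hsU)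
  have hfin := finite_of_attractors hΓ (isOpen_biUnion fun i (_ : i ∈ t) => hUo i)
    {g | ofGroup g ∉ ⋃ i ∈ t, U i} (fun g hg => hg) (fun _ a _ _ _ => ht ⟨a, rfl⟩)
  choose f hf using fun z : GroupUnion Γ => mem_iUnion.1 (hsU (mem_univ z))
  classical
  refine ⟨t ∪ hfin.toFinset.image (fun g => f (ofGroup g)), fun z _ => ?_⟩
  by_cases hz : z ∈ ⋃ i ∈ t, U i
  · obtain ⟨i, hi, hzi⟩ := mem_iUnion₂.1 hz
    exact mem_iUnion₂.2 ⟨i, Finset.mem_union_left _ hi, hzi⟩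
  · rcases z with g | x
    · refine mem_iUnion₂.2 ⟨f (ofGroup g), Finset.mem_union_right _ ?_, hf _⟩
      exact Finset.mem_image.2 ⟨g, hfin.mem_toFinset.2 hz, rfl⟩
    · exact absurd (ht ⟨x, rfl⟩) hz

lemma t2Space_union (Γ : Subgroup (M ≃ₜ M)) {p : Fin 3 → M} (hp : Function.Injective p) :
    @T2Space (GroupUnion Γ) (unionTopology Γ) := by
  let _ := unionTopology Γ
  have key : ∀ (g : Γ) (z : GroupUnion Γ), ofGroup g ≠ z →
      ∃ u v : Set (GroupUnion Γ), IsOpen u ∧ IsOpen v ∧ ofGroup g ∈ u ∧ z ∈ v ∧ Disjoint u v := by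
    intro g z hz
    have h := isOpen_diff_finite Γ (@isOpen_univ _ (unionTopology Γ)) {g}
    refine ⟨_, _, isOpen_singleton_group Γ g, h, rfl, ⟨mem_univ _, ?_⟩, ?_⟩
    · simpa using hz.symm
    · rw [Set.disjoint_left]
      rintro _ rfl h2
      exact h2.2 ⟨g, by simp, rfl⟩
  refine ⟨fun z w hzw => ?_⟩
  rcases z with g | x
  · exact key g w hzw
  · rcases w with g | y
    · obtain ⟨u, v, hu, hv, h1, h2, h3⟩ := key g _ hzw.symm
      exact ⟨v, u, hv, hu, h2, h1, h3.symm⟩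
    · have hxy : x ≠ y := fun h => hzw (by rw [h])
      obtain ⟨A, B, hA, hB, hx, hy, hAB⟩ := t2_separation hxy
      exact ⟨_, _, isOpen_hat Γ hp hA, isOpen_hat Γ hp hB, hx, hy, disjoint_hat Γ p hAB⟩

lemma secondCountable_union [CompactSpace M] {Γ : Subgroup (M ≃ₜ M)}
    (hΓ : IsConvergenceGroup Γ) {p : Fin 3 → M} (hp : Function.Injective p) :
    @SecondCountableTopology (GroupUnion Γ) (unionTopology Γ) := by
  let _ := unionTopology Γ
  have := hΓ.countable
  let 𝒜 := TopologicalSpace.countableBasis M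
  let ℬ : Set (Set (GroupUnion Γ)) :=
    (fun AF : Set M × Finset Γ => hat Γ p AF.1 \ ofGroup '' (AF.2 : Set Γ)) ''
      (𝒜 ×ˢ univ) ∪ range (fun g : Γ => {ofGroup g})
  have hcount : ℬ.Countable :=
    (((TopologicalSpace.countable_countableBasis M).prod countable_univ).image _).union
      (countable_range _)
  refine (TopologicalSpace.isTopologicalBasis_of_isOpen_of_nhds
    (s := ℬ) ?_ ?_).secondCountableTopology hcount
  · rintro _ (⟨⟨A, F⟩, ⟨hA, _⟩, rfl⟩ | ⟨g, rfl⟩)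
    · exact isOpen_diff_finite Γ
        (isOpen_hat Γ hp (TopologicalSpace.isOpen_of_mem_countableBasis hA)) F
    · exact isOpen_singleton_group Γ g
  · rintro (g | x) U hz hU
    · exact ⟨_, Or.inr ⟨g, rfl⟩, rfl, by rintro _ rfl; exact hz⟩
    · obtain ⟨V, hV, hVc, hVU⟩ := exists_mem_nhds_isClosed_subset (hU.1.mem_nhds hz)
      obtain ⟨A, hA, hxA, hAV⟩ :=
        (TopologicalSpace.isBasis_countableBasis M).mem_nhds_iff.1 hV
      have hfin := finite_of_attractors hΓ hU {g | ofGroup g ∈ hat Γ p A \ U}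
        (fun g hg => hg.2) (fun γ a b hγ hc => by
          apply hVU
          obtain ⟨i, j, hij, hi, hj⟩ := exists_pair hp b
          by_contra ha
          have hn : Vᶜ ∈ 𝓝 a := hVc.isOpen_compl.mem_nhds ha
          obtain ⟨n, h1, h2⟩ := (((hc.tendsto hi).eventually hn).and ((hc.tendsto hj).eventually hn)).exists
          obtain ⟨k, l, hkl, hk, hl⟩ := (hγ n).1
          rcases common_index i j k l hij hkl with rfl | rfl | rfl | rfl
          exacts [h1 (hAV hk), h1 (hAV hl), h2 (hAV hk), h2 (hAV hl)])
      refine ⟨_, Or.inl ⟨(A, hfin.toFinset), ⟨hA, mem_univ _⟩, rfl⟩, ⟨hxA, ?_⟩, ?_⟩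
      · rintro ⟨g, _, hg⟩
        exact Sum.inl_ne_inr hg
      · rintro (g | y) ⟨h1, h2⟩
        · by_contra h3
          exact h2 ⟨g, by simpa using ⟨h1, h3⟩, rfl⟩
        · exact hVU (hAV h1)

/-- Compatible metrics exist. -/
theorem exists_isCompatible [CompactSpace M] {Γ : Subgroup (M ≃ₜ M)} (hΓ : IsConvergenceGroup Γ)
    (hne : IsNonElementary Γ) : ∃ d : MetricSpace (GroupUnion Γ), IsCompatible d := by
  obtain ⟨t, _, ht⟩ := Set.exists_subset_encard_eq hne
  obtain ⟨x, y, z, hxy, hxz, hyz, rfl⟩ := Set.encard_eq_three.1 ht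
  have hp : Function.Injective ![x, y, z] := by
    intro i j h
    fin_cases i <;> fin_cases j <;> simp_all [eq_comm]
  let _ := unionTopology Γ
  have := compactSpace_union hΓ
  have := t2Space_union Γ hp
  have := secondCountable_union hΓ hp
  exact ⟨TopologicalSpace.metrizableSpaceMetric (GroupUnion Γ), rfl⟩

end BishopJones

/-! Fix `δ'` strictly between `δ` and the critical exponent of `Γ`, so that the Poincaré series of
`Γ` diverges at `δ'`. Compactness of `Γ ⊔ M` concentrates the divergence on the elements `γ` with
`(γ, γ⁻¹)` close to a single pair `(u, v)` of points of `M`. A non-elementary convergence group has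
no global fixed point (`exists_apply_ne`), so a left translation makes `u ≠ v`
(`IsExpanding.exists_localized_ne`). All but finitely many elements contract the complement of a
ball around `γ⁻¹` into a ball around `γ` (`IsCompatible.eventually_contracting`), so the selected
elements play ping-pong near `u`.

Two facts about magnitudes carry the estimates: they are quasi-additive on pairs `α`, `β` with `α⁻¹`
and `β` far apart (`IsCompatible.exists_abs_mag_mul_le`), and they are proper
(`IsExpanding.tendsto_mag`). Divergence at `δ'` gives shells `n ≤ ‖γ‖ < n + 1`, with `n` arbitrarily
large, that contain at least `e^{tn}` selected elements, for a `t` between `δ` and `δ'`. Two of them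
whose images of the ball around `u` meet differ by an element of a finite set independent of `n`
(`IsExpanding.exists_finite_separating`), so a fixed proportion have disjoint images and generate a
free semigroup.

Keep about `e^{δn}` of these generators. Words of length `m` have magnitude `nm + O(m)`, and there
are `(#S)^m` of them, so the critical exponent is about `log(#S)/n`; for large `n` it lies between
`δ` and `δ'`. This gives (1) and the strict inequality (4), and the same word count gives (3). For
(2), properness makes long words exceed the quasi-additivity defect, so each block of a fixed length
adds at least 1 to the magnitude. Property (5) compares both magnitudes with word length. -/

namespace BishopJones

/-! ### Convergence sequences, loxodromic elements and absence of global fixed points. -/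

variable {M : Type*} [MetricSpace M]

/-- By compactness of `M`, convergence is uniform off each neighbourhood of `b`. In this form the
roles of `a` and `b` are exchanged by contraposition, which is why inverses converge to `b` off `a`.
-/
lemma convergesOff_iff [CompactSpace M] {γ : ℕ → M ≃ₜ M} {a b : M} :
    ConvergesOff γ a b ↔ ∀ U ∈ 𝓝 a, ∀ V ∈ 𝓝 b, ∀ᶠ n in atTop, ∀ x ∉ V, γ n x ∈ U := by
  constructor
  · intro h U hU V hV
    have hK : IsCompact (interior V)ᶜ := isOpen_interior.isClosed_compl.isCompact
    have hsub : (interior V)ᶜ ⊆ ({b}ᶜ : Set M) := by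
      intro x hx hxb
      rw [mem_singleton_iff.1 hxb] at hx
      exact hx (mem_interior_iff_mem_nhds.2 hV)
    have := (tendstoLocallyUniformlyOn_iff_forall_isCompact isOpen_compl_singleton).1 h _ hsub hK
    obtain ⟨r, hr, hrU⟩ := Metric.mem_nhds_iff.1 hU
    filter_upwards [Metric.tendstoUniformlyOn_iff.1 this r hr] with n hn x hx
    exact hrU (by rw [Metric.mem_ball, dist_comm]; exact hn x fun h => hx (interior_subset h))
  · intro h
    refine Metric.tendstoLocallyUniformlyOn_iff.2 fun ε hε x hx => ?_
    obtain ⟨V, W, hV, hW, hbV, hxW, hVW⟩ := t2_separation (Ne.symm hx)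
    refine ⟨W, mem_nhdsWithin_of_mem_nhds (hW.mem_nhds hxW), ?_⟩
    filter_upwards [h _ (Metric.ball_mem_nhds a hε) V (hV.mem_nhds hbV)] with n hn y hy
    rw [dist_comm]
    exact hn y fun hyV => hVW.le_bot ⟨hyV, hy⟩

lemma ConvergesOff.inv [CompactSpace M] {γ : ℕ → M ≃ₜ M} {a b : M} (h : ConvergesOff γ a b) :
    ConvergesOff (fun n => (γ n)⁻¹) b a := by
  rw [convergesOff_iff] at h ⊢
  intro U hU V hV
  filter_upwards [h V hV U hU] with n hn x hx
  by_contra hxU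
  exact hx (by simpa using hn _ hxU)

lemma ConvergesOff.comp {γ : ℕ → M ≃ₜ M} {a b : M} (h : ConvergesOff γ a b) {k : ℕ → ℕ}
    (hk : Tendsto k atTop atTop) : ConvergesOff (fun n => γ (k n)) a b := by
  intro u hu x hx
  obtain ⟨t, ht, h'⟩ := h u hu x hx
  exact ⟨t, ht, hk.eventually h'⟩

lemma ConvergesOff.mul_left [CompactSpace M] {γ : ℕ → M ≃ₜ M} {a b : M}
    (h : ConvergesOff γ a b) (g : M ≃ₜ M) : ConvergesOff (fun n => g * γ n) (g a) b := by
  rw [convergesOff_iff] at h ⊢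
  intro U hU V hV
  exact h _ (g.continuous.continuousAt hU) V hV

lemma ConvergesOff.mul_right [CompactSpace M] {γ : ℕ → M ≃ₜ M} {a b : M}
    (h : ConvergesOff γ a b) (g : M ≃ₜ M) : ConvergesOff (fun n => γ n * g) a (g⁻¹ b) := by
  rw [convergesOff_iff] at h ⊢
  intro U hU V hV
  have hV' : (g⁻¹ : M ≃ₜ M) ⁻¹' V ∈ 𝓝 b := (g⁻¹ : M ≃ₜ M).continuous.continuousAt hV
  filter_upwards [h U hU _ hV'] with n hn x hx
  exact hn _ (by simpa using hx)

lemma exists_three_points {Γ : Subgroup (M ≃ₜ M)} (hne : IsNonElementary Γ) :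
    ∃ p : Fin 3 → M, Function.Injective p ∧ ∀ i, p i ∈ limitSet Γ := by
  obtain ⟨t, ht', ht⟩ := Set.exists_subset_encard_eq hne
  obtain ⟨x, y, z, hxy, hxz, hyz, rfl⟩ := Set.encard_eq_three.1 ht
  refine ⟨![x, y, z], ?_, ?_⟩
  · intro i j h
    fin_cases i <;> fin_cases j <;> simp_all [eq_comm]
  · intro i
    fin_cases i <;> exact ht' (by simp)

lemma exists_ne_ne {X : Type*} {p : Fin 3 → X} (hp : Function.Injective p) (a b : X) :
    ∃ i, p i ≠ a ∧ p i ≠ b := by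
  obtain ⟨i, j, hij, hi, hj⟩ := exists_pair hp a
  by_cases h : p i = b
  · exact ⟨j, hj, fun h' => hij (hp (h.trans h'.symm))⟩
  · exact ⟨i, hi, h⟩

/-- A homeomorphism in a convergence group that maps the complement of `V` into the interior of
`U` is loxodromic. -/
lemma exists_isLoxodromic_of_mapsTo [CompactSpace M] {Γ : Subgroup (M ≃ₜ M)}
    (hΓ : IsConvergenceGroup Γ) {γ : Γ} {U V : Set M} {c : M} (hU : IsClosed U) (hV : IsClosed V)
    (hUV : Disjoint U V) (hcU : c ∉ U) (hcV : c ∉ V)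
    (hγ : ∀ x ∉ V, (γ : M ≃ₜ M) x ∈ interior U) :
    ∃ p ∈ U, ∃ q ∈ V, IsLoxodromic Γ γ p q := by
  set g : M ≃ₜ M := (γ : M ≃ₜ M) with hg
  have hUV' : ∀ x ∈ U, x ∉ V := fun x hx hx' => hUV.le_bot ⟨hx, hx'⟩
  have hpowU : ∀ (n : ℕ), ∀ x ∈ U, (g ^ n) x ∈ U := by
    intro n
    induction n with
    | zero => intro x hx; simpa using hx
    | succ n ih =>
      intro x hx
      rw [pow_succ, Homeomorph.mul_apply]
      exact ih _ (interior_subset (hγ x (hUV' x hx)))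
  have hpow : ∀ (n : ℕ), n ≠ 0 → ∀ x ∉ V, (g ^ n) x ∈ U := by
    intro n hn x hx
    obtain ⟨m, rfl⟩ := Nat.exists_eq_succ_of_ne_zero hn
    rw [Nat.succ_eq_add_one, pow_succ, Homeomorph.mul_apply]
    exact hpowU _ _ (interior_subset (hγ x hx))
  -- A positive power equal to 1 would fix `c`, but all positive powers move `c` into `U`.
  have hinj : Function.Injective (fun n : ℕ => γ ^ n) := by
    rw [injective_pow_iff_not_isOfFinOrder, isOfFinOrder_iff_pow_eq_one]
    rintro ⟨n, hn, h⟩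
    have h' : g ^ n = 1 := by rw [hg, ← Subgroup.coe_pow, h, Subgroup.coe_one]
    have := hpow n hn.ne' c hcV
    rw [h'] at this
    exact hcU (by simpa using this)
  obtain ⟨p, q, k, hk, hconv⟩ := hΓ.exists_subseq _ hinj
  have hconv : ConvergesOff (fun n => g ^ k n) p q := by simpa using hconv
  have hinv := hconv.inv
  have hgc : g c ∈ U := interior_subset (hγ c hcV)
  have hk0 : ∀ᶠ n in atTop, k n ≠ 0 := by
    filter_upwards [eventually_ge_atTop 1] with n hn
    have := hk.le_apply (x := n)
    omega
  have hpU : p ∈ U := by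
    obtain ⟨x, hxV, hxq⟩ : ∃ x, x ∉ V ∧ x ≠ q := by
      by_cases h : c = q
      · refine ⟨g c, hUV' _ hgc, fun h' => hcU ?_⟩
        rw [h, ← h']; exact hgc
      · exact ⟨c, hcV, h⟩
    exact hU.mem_of_tendsto (hconv.tendsto hxq) (hk0.mono fun n hn => hpow _ hn x hxV)
  have hcp : c ≠ p := fun h => hcU (h ▸ hpU)
  have hqV : q ∈ V := by
    refine hV.mem_of_tendsto (hinv.tendsto hcp) (hk0.mono fun n hn => ?_)
    by_contra h
    have := hpow _ hn _ h
    rw [← Homeomorph.mul_apply, mul_inv_cancel] at this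
    exact hcU this
  have hcq : c ≠ q := fun h => hcV (h ▸ hqV)
  have hfp : g p = p := by
    have h1 := (g.continuous.tendsto p).comp (hconv.tendsto hcq)
    have h2 := hconv.tendsto (x := g c) (fun h => hUV' _ hgc (h ▸ hqV))
    refine tendsto_nhds_unique (h1.congr fun n => ?_) h2
    simp only [Function.comp, ← Homeomorph.mul_apply]
    rw [(Commute.self_pow g (k n)).eq]
  have hfq : g q = q := by
    have h1 := ((g⁻¹ : M ≃ₜ M).continuous.tendsto q).comp (hinv.tendsto hcp)
    have h2 := hinv.tendsto (x := g⁻¹ c) (fun h => by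
      have : g⁻¹ c ∈ V := by
        by_contra h'
        have := interior_subset (hγ _ h')
        rw [← Homeomorph.mul_apply, mul_inv_cancel] at this
        exact hcU this
      exact hUV' _ hpU (h ▸ this))
    have h3 : g⁻¹ q = q := by
      refine tendsto_nhds_unique (h1.congr fun n => ?_) h2
      simp only [Function.comp, ← Homeomorph.mul_apply]
      rw [← mul_inv_rev, ← mul_inv_rev, (Commute.self_pow g (k n)).eq]
    conv_lhs => rw [← h3]
    rw [← Homeomorph.mul_apply, mul_inv_cancel, Homeomorph.one_apply]
  have hpint : p ∈ interior U := by
    have := hγ p (hUV' p hpU)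
    rwa [hfp] at this
  -- From the subsequence to all powers: one power in it sends the complement of `V'` into `U`,
  -- further powers of `g` preserve `U`, and another power in it sends `U` into `W`, because `Uᶜ` is
  -- a neighbourhood of `q`.
  have hmain : ConvergesOff (fun n => g ^ n) p q := by
    rw [convergesOff_iff] at hconv ⊢
    intro W hW V' hV'
    obtain ⟨i, hi⟩ := (hconv U (mem_interior_iff_mem_nhds.1 hpint) V' hV').exists
    obtain ⟨j, hj⟩ := (hconv W hW Uᶜ
      (hU.isOpen_compl.mem_nhds fun h => hUV' _ h hqV)).exists
    filter_upwards [eventually_ge_atTop (k j + k i)] with n hn x hx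
    obtain ⟨m, rfl⟩ := Nat.exists_eq_add_of_le hn
    have : g ^ (k j + k i + m) = g ^ k j * (g ^ m * g ^ k i) := by
      rw [← pow_add, ← pow_add]; congr 1; omega
    rw [this, Homeomorph.mul_apply]
    refine hj _ ?_
    rw [notMem_compl_iff, Homeomorph.mul_apply]
    exact hpowU _ _ (hi x hx)
  have hmain' : ConvergesOff (fun n => g⁻¹ ^ n) q p := by simpa using hmain.inv
  exact ⟨p, hpU, q, hqV, fun h => hUV' _ hpU (h ▸ hqV),
    ⟨q, fun n => γ ^ n, by simpa using hmain⟩, ⟨p, fun n => γ⁻¹ ^ n, by simpa using hmain'⟩,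
    hfp, hfq, hmain, hmain'⟩

/-- Since `a ≠ b`, the two neighbourhoods can be shrunk to disjoint closed sets that miss a third
point, and `exists_isLoxodromic_of_mapsTo` applies. -/
lemma eventually_isLoxodromic [CompactSpace M] {Γ : Subgroup (M ≃ₜ M)}
    (hΓ : IsConvergenceGroup Γ) (hne : IsNonElementary Γ) {γ : ℕ → Γ} {a b : M}
    (h : ConvergesOff (fun n => (γ n : M ≃ₜ M)) a b) (hab : a ≠ b) {U V : Set M}
    (hU : U ∈ 𝓝 a) (hV : V ∈ 𝓝 b) :
    ∀ᶠ n in atTop, ∃ p ∈ U, ∃ q ∈ V, IsLoxodromic Γ (γ n) p q := by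
  obtain ⟨t, ht, -⟩ := exists_three_points hne
  obtain ⟨i, hia, hib⟩ := exists_ne_ne ht a b
  obtain ⟨A, B, hA, hB, haA, hbB, hAB⟩ := t2_separation hab
  obtain ⟨U', hU', hU'c, hU's⟩ := exists_mem_nhds_isClosed_subset
    (inter_mem (inter_mem hU (hA.mem_nhds haA)) (isOpen_compl_singleton.mem_nhds hia.symm))
  obtain ⟨V', hV', hV'c, hV's⟩ := exists_mem_nhds_isClosed_subset
    (inter_mem (inter_mem hV (hB.mem_nhds hbB)) (isOpen_compl_singleton.mem_nhds hib.symm))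
  filter_upwards [convergesOff_iff.1 h _ (interior_mem_nhds.2 hU') V' hV'] with n hn
  obtain ⟨p, hp, q, hq, hl⟩ := exists_isLoxodromic_of_mapsTo hΓ hU'c hV'c
    (hAB.mono (fun x hx => (hU's hx).1.2) (fun x hx => (hV's hx).1.2))
    (fun h' => (hU's h').2 rfl) (fun h' => (hV's h').2 rfl) hn
  exact ⟨p, (hU's hp).1.1, q, (hV's hq).1.1, hl⟩

lemma IsLoxodromic.inv {Γ : Subgroup (M ≃ₜ M)} {γ : Γ} {p q : M}
    (h : IsLoxodromic Γ γ p q) : IsLoxodromic Γ γ⁻¹ q p where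
  ne := h.ne.symm
  mem_attracting := h.mem_repelling
  mem_repelling := h.mem_attracting
  fixed_attracting := by
    conv_lhs => rw [← h.fixed_repelling]
    simp
  fixed_repelling := by
    conv_lhs => rw [← h.fixed_attracting]
    simp
  tendsto_attracting := by simpa using h.tendsto_repelling
  tendsto_repelling := by simpa using h.tendsto_attracting

lemma homeomorph_pow_fixed {g : M ≃ₜ M} {x : M} (hx : g x = x) (n : ℕ) : (g ^ n) x = x := by
  induction n with
  | zero => simp
  | succ n ih => rw [pow_succ, Homeomorph.mul_apply, hx, ih]

lemma IsLoxodromic.eq_or_eq_of_fixed {Γ : Subgroup (M ≃ₜ M)} {γ : Γ} {p q x : M}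
    (h : IsLoxodromic Γ γ p q) (hx : (γ : M ≃ₜ M) x = x) : x = p ∨ x = q := by
  by_contra! hpq
  have h1 := h.tendsto_attracting.tendsto hpq.2
  simp only [homeomorph_pow_fixed hx] at h1
  exact hpq.1 (tendsto_nhds_unique tendsto_const_nhds h1)

/-- A sequence of distinct elements cannot send three distinct points to three distinct limits. -/
lemma not_three_limits {Γ : Subgroup (M ≃ₜ M)} (hΓ : IsConvergenceGroup Γ) {γ : ℕ → Γ}
    (hγ : Function.Injective γ) {x y : Fin 3 → M} (hx : Function.Injective x)
    (hy : Function.Injective y)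
    (h : ∀ i, Tendsto (fun n => (γ n : M ≃ₜ M) (x i)) atTop (𝓝 (y i))) : False := by
  obtain ⟨a, b, k, hk, hc⟩ := hΓ.exists_subseq γ hγ
  obtain ⟨i, j, hij, hi, hj⟩ := exists_pair hx b
  have hi' := tendsto_nhds_unique ((h i).comp hk.tendsto_atTop) (hc.tendsto hi)
  have hj' := tendsto_nhds_unique ((h j).comp hk.tendsto_atTop) (hc.tendsto hj)
  exact hij (hy (hi'.trans hj'.symm))

lemma injective_vec3 {X : Type*} {x y z : X} (hxy : x ≠ y) (hxz : x ≠ z) (hyz : y ≠ z) :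
    Function.Injective ![x, y, z] := by
  intro i j h
  fin_cases i <;> fin_cases j <;> simp_all [eq_comm]

/-- Loxodromic elements with the same repelling fixed point have the same attracting one. -/
lemma IsLoxodromic.attracting_unique [CompactSpace M] {Γ : Subgroup (M ≃ₜ M)}
    (hΓ : IsConvergenceGroup Γ) (hne : IsNonElementary Γ) {g h : Γ} {p p' u : M}
    (hg : IsLoxodromic Γ g p u) (hh : IsLoxodromic Γ h p' u) : p = p' := by
  -- Let `m n` be the first time that `h ^ m` moves `g⁻ⁿ x` out of a small neighbourhood `V` of `u`.
  -- Then `h ^ m n * g⁻ⁿ` fixes `u`, sends `p` towards `p'` and `x` into a compact set without `u`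
  -- and `p'`. Along a subsequence, three distinct points get three distinct limits, which the
  -- convergence property forbids.
  by_contra hpp
  obtain ⟨t, ht, -⟩ := exists_three_points hne
  obtain ⟨i, hip, hiu⟩ := exists_ne_ne ht p u
  set x := t i
  -- a neighbourhood `V` of `u` whose closure misses `p'`
  obtain ⟨V, hV, hVc, hVs⟩ := exists_mem_nhds_isClosed_subset
    (isOpen_compl_singleton.mem_nhds (show u ∈ ({p'}ᶜ : Set M) from hh.ne.symm))
  have hp'V : p' ∉ V := fun h => hVs h rfl
  have hgx : Tendsto (fun n => ((g : M ≃ₜ M)⁻¹ ^ n) x) atTop (𝓝 u) := hg.tendsto_repelling.tendsto hip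
  have hne_u : ∀ n, ((g : M ≃ₜ M)⁻¹ ^ n) x ≠ u := by
    intro n hn
    have hu : ((g : M ≃ₜ M)⁻¹ ^ n) u = u :=
      homeomorph_pow_fixed hg.inv.fixed_attracting n
    exact hiu (((g : M ≃ₜ M)⁻¹ ^ n).injective (hn.trans hu.symm))
  have hexit : ∀ n, ∃ m, ((h : M ≃ₜ M) ^ m) (((g : M ≃ₜ M)⁻¹ ^ n) x) ∉ V := fun n =>
    ((hh.tendsto_attracting.tendsto (hne_u n)).eventually
      (hVc.isOpen_compl.mem_nhds hp'V)).exists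
  classical
  let m : ℕ → ℕ := fun n => Nat.find (hexit n)
  have hm : ∀ n, ((h : M ≃ₜ M) ^ m n) (((g : M ≃ₜ M)⁻¹ ^ n) x) ∉ V := fun n => Nat.find_spec (hexit n)
  have hm' : ∀ n, ∀ j < m n, ((h : M ≃ₜ M) ^ j) (((g : M ≃ₜ M)⁻¹ ^ n) x) ∈ V := fun n j hj =>
    not_not.1 (Nat.find_min (hexit n) hj)
  have hm_top : Tendsto m atTop atTop := by
    refine tendsto_atTop.2 fun j => ?_
    have hcont : ∀ l, ∀ᶠ n in atTop, ((h : M ≃ₜ M) ^ l) (((g : M ≃ₜ M)⁻¹ ^ n) x) ∈ V := by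
      intro l
      have h1 := (((h : M ≃ₜ M) ^ l).continuous.tendsto u).comp hgx
      rw [homeomorph_pow_fixed hh.fixed_repelling] at h1
      exact h1 hV
    have : ∀ᶠ n in atTop, ∀ l ∈ Finset.range j,
        ((h : M ≃ₜ M) ^ l) (((g : M ≃ₜ M)⁻¹ ^ n) x) ∈ V :=
      (Finset.eventually_all _).2 fun l _ => hcont l
    filter_upwards [this] with n hn
    by_contra! hlt
    exact hm n (hn _ (Finset.mem_range.2 hlt))
  -- A first exit point is outside `V`, hence away from `u`, and it lies in `h(V)`, which misses
  -- `p'` because `h` fixes `p' ∉ V`.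
  let K : Set M := (interior V)ᶜ ∩ (h : M ≃ₜ M) '' V
  have hKc : IsCompact K := (isOpen_interior.isClosed_compl.inter ((h : M ≃ₜ M).isClosed_image.2 hVc)).isCompact
  have hyK : ∀ᶠ n in atTop, ((h : M ≃ₜ M) ^ m n) (((g : M ≃ₜ M)⁻¹ ^ n) x) ∈ K := by
    filter_upwards [hm_top.eventually_ge_atTop 1] with n hn
    refine ⟨fun h => hm n (interior_subset h), ?_⟩
    refine ⟨((h : M ≃ₜ M) ^ (m n - 1)) (((g : M ≃ₜ M)⁻¹ ^ n) x), hm' n _ (by omega), ?_⟩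
    rw [← Homeomorph.mul_apply, ← pow_succ', Nat.sub_add_cancel hn]
  obtain ⟨N, hN⟩ := eventually_atTop.1 hyK
  obtain ⟨y, hy, k, hk, hky⟩ := hKc.tendsto_subseq (fun n => hN (n + N) (Nat.le_add_left N n))
  have hyu : y ≠ u := by
    rintro rfl
    exact hy.1 (mem_interior_iff_mem_nhds.2 hV)
  have hyp' : y ≠ p' := by
    rintro rfl
    obtain ⟨z, hz, hz'⟩ := hy.2
    have := (h : M ≃ₜ M).injective (hz'.trans hh.fixed_attracting.symm)
    exact hp'V (this ▸ hz)
  have hmk : Tendsto (fun n => m (k n + N)) atTop atTop :=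
    hm_top.comp ((tendsto_add_atTop_nat N).comp hk.tendsto_atTop)
  obtain ⟨l, hl, hlm⟩ := strictMono_subseq_of_tendsto_atTop hmk
  let f : ℕ → Γ := fun n => h ^ m (k (l n) + N) * g⁻¹ ^ (k (l n) + N)
  have hfp : ∀ n, (f n : M ≃ₜ M) p = ((h : M ≃ₜ M) ^ m (k (l n) + N)) p := by
    intro n
    have : ((g : M ≃ₜ M)⁻¹ ^ (k (l n) + N)) p = p :=
      homeomorph_pow_fixed hg.inv.fixed_repelling _
    simp only [f, Subgroup.coe_mul, Subgroup.coe_pow, Subgroup.coe_inv, Homeomorph.mul_apply, this]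
  have hfu : ∀ n, (f n : M ≃ₜ M) u = u := by
    intro n
    have h1 : ((g : M ≃ₜ M)⁻¹ ^ (k (l n) + N)) u = u :=
      homeomorph_pow_fixed hg.inv.fixed_attracting _
    simp only [f, Subgroup.coe_mul, Subgroup.coe_pow, Subgroup.coe_inv, Homeomorph.mul_apply, h1]
    exact homeomorph_pow_fixed hh.fixed_repelling _
  -- Otherwise `p` is periodic under `h`, against `h ^ n p → p' ≠ p`. This makes the elements `f n`
  -- distinct.
  have hpow_inj : ∀ i j : ℕ, i < j → ((h : M ≃ₜ M) ^ i) p ≠ ((h : M ≃ₜ M) ^ j) p := by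
    intro i j hij hEq
    obtain ⟨e, rfl⟩ := Nat.exists_eq_add_of_lt hij
    rw [add_assoc, pow_add, Homeomorph.mul_apply] at hEq
    have hfix := (((h : M ≃ₜ M) ^ i).injective hEq).symm
    have h1 := (hh.tendsto_attracting.comp
      (tendsto_id.atTop_mul_const' (show 0 < e + 1 by omega))).tendsto hg.ne
    have h2 : ∀ n : ℕ, ((h : M ≃ₜ M) ^ (n * (e + 1))) p = p := fun n => by
      rw [mul_comm, pow_mul]; exact homeomorph_pow_fixed hfix n
    simp only [id, h2] at h1
    exact hpp (tendsto_nhds_unique tendsto_const_nhds h1)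
  have hf : Function.Injective f := by
    intro a b hab
    by_contra hne'
    have hEq := (hfp a).symm.trans ((congrArg (fun z : Γ => (z : M ≃ₜ M) p) hab).trans (hfp b))
    rcases lt_or_gt_of_ne hne' with h' | h'
    · exact hpow_inj _ _ (hlm h') hEq
    · exact hpow_inj _ _ (hlm h') hEq.symm
  refine not_three_limits hΓ hf (x := ![u, x, p]) (y := ![u, y, p'])
    (injective_vec3 (Ne.symm hiu) hg.ne.symm hip) (injective_vec3 hyu.symm hh.ne.symm hyp') ?_
  intro i
  fin_cases i
  · simp [hfu]
  · simpa [f, Function.comp_def] using hky.comp hl.tendsto_atTop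
  · simpa [hfp, Function.comp_def] using (hh.tendsto_attracting.tendsto hg.ne).comp hlm.tendsto_atTop

/-- A non-elementary convergence group has no global fixed point. -/
lemma exists_apply_ne [CompactSpace M] {Γ : Subgroup (M ≃ₜ M)}
    (hΓ : IsConvergenceGroup Γ) (hne : IsNonElementary Γ) (u : M) :
    ∃ g : Γ, (g : M ≃ₜ M) u ≠ u := by
  by_contra! hfix
  obtain ⟨t, ht, htΛ⟩ := exists_three_points hne
  -- A fixed `u` must be the repelling point of every sequence that converges to `c ≠ u`, and of the
  -- loxodromic elements that it produces. Two limit points other than `u` then contradict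
  -- `attracting_unique`.
  have key : ∀ c ∈ limitSet Γ, c ≠ u → ∀ U ∈ 𝓝 c, ∃ p ∈ U, ∃ g : Γ, IsLoxodromic Γ g p u := by
    rintro c ⟨e, γ, hγ⟩ hcu U hU
    have heu : e = u := by
      by_contra heu
      have := hγ.tendsto (Ne.symm heu)
      simp only [hfix] at this
      exact hcu (tendsto_nhds_unique this tendsto_const_nhds)
    subst heu
    obtain ⟨n, p, hp, q, -, hl⟩ := (eventually_isLoxodromic hΓ hne hγ hcu
      (inter_mem hU (isOpen_compl_singleton.mem_nhds hcu)) univ_mem).exists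
    rcases hl.eq_or_eq_of_fixed (hfix _) with h | h
    · exact absurd h.symm hp.2
    · exact ⟨p, hp.1, γ n, h ▸ hl⟩
  obtain ⟨i, j, hij, hi, hj⟩ := exists_pair ht u
  obtain ⟨A, B, hA, hB, hiA, hjB, hAB⟩ := t2_separation (fun h => hij (ht h) : t i ≠ t j)
  obtain ⟨p, hp, g, hg⟩ := key _ (htΛ i) hi A (hA.mem_nhds hiA)
  obtain ⟨p', hp', h, hh⟩ := key _ (htΛ j) hj B (hB.mem_nhds hjB)
  exact hAB.le_bot ⟨hp, (hg.attracting_unique hΓ hne hh) ▸ hp'⟩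

end BishopJones

/-! ### The compactification `Γ ⊔ M` and the contraction property. -/

namespace BishopJones

variable {M : Type*} [MetricSpace M] {Γ : Subgroup (M ≃ₜ M)}

/-- Reduces finiteness to sequences: an infinite set of exceptions would contain a convergent
sequence of distinct elements. -/
lemma IsConvergenceGroup.eventually_cofinite (hΓ : IsConvergenceGroup Γ) {P : Γ → Prop}
    (h : ∀ (γ : ℕ → Γ) (a b : M), Function.Injective γ →
      ConvergesOff (fun n => (γ n : M ≃ₜ M)) a b → ∃ n, P (γ n)) : ∀ᶠ γ in cofinite, P γ := by
  by_contra hinf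
  have hinf : {γ | ¬ P γ}.Infinite := hinf
  have hinj : Function.Injective fun n => (hinf.natEmbedding _ n : Γ) :=
    Subtype.val_injective.comp (hinf.natEmbedding _).injective
  obtain ⟨a, b, k, hk, hc⟩ := hΓ.exists_subseq _ hinj
  obtain ⟨n, hn⟩ := h _ a b (hinj.comp hk.injective) hc
  exact (hinf.natEmbedding _ (k n)).2 hn

/-- The action of `g` on `Γ ⊔ M`. -/
def leftMul (g : Γ) : GroupUnion Γ → GroupUnion Γ := Sum.map (g * ·) (g : M ≃ₜ M)

/-- Right multiplication by `g` on `Γ`, extended by the identity of `M`. -/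
def rightMul (g : Γ) : GroupUnion Γ → GroupUnion Γ := Sum.map (· * g) id

section Metric

variable [d : MetricSpace (GroupUnion Γ)]

lemma IsCompatible.isOpen_iff (hd : IsCompatible d) {U : Set (GroupUnion Γ)} :
    IsOpen U ↔ IsOpen[unionTopology Γ] U := by
  rw [← hd]

lemma IsCompatible.continuous_ofSpace (hd : IsCompatible d) : Continuous (ofSpace Γ) :=
  ⟨fun _ hU => (hd.isOpen_iff.1 hU).1⟩

lemma IsCompatible.tendsto_ofGroup (hd : IsCompatible d) {γ : ℕ → Γ} {a b : M}
    (hγ : Function.Injective γ) (h : ConvergesOff (fun n => (γ n : M ≃ₜ M)) a b) :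
    Tendsto (fun n => (ofGroup (γ n) : GroupUnion Γ)) atTop (𝓝 (ofSpace Γ a)) :=
  tendsto_nhds.2 fun _ hU ha => (hd.isOpen_iff.1 hU).2 γ a b hγ h ha

lemma IsCompatible.tendsto_ofGroup_inv [CompactSpace M] (hd : IsCompatible d) {γ : ℕ → Γ} {a b : M}
    (hγ : Function.Injective γ) (h : ConvergesOff (fun n => (γ n : M ≃ₜ M)) a b) :
    Tendsto (fun n => (ofGroup (γ n)⁻¹ : GroupUnion Γ)) atTop (𝓝 (ofSpace Γ b)) :=
  hd.tendsto_ofGroup (inv_injective.comp hγ) (by simpa using h.inv)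

lemma IsCompatible.isOpen_singleton (hd : IsCompatible d) (γ : Γ) :
    IsOpen {(ofGroup γ : GroupUnion Γ)} :=
  hd.isOpen_iff.2 (isOpen_singleton_group Γ γ)

lemma IsCompatible.exists_isolated (hd : IsCompatible d) (γ : Γ) :
    ∃ r > 0, ∀ z : GroupUnion Γ, z ≠ ofGroup γ → r < dist (ofGroup γ) z := by
  obtain ⟨r, hr, h⟩ := Metric.isOpen_iff.1 (hd.isOpen_singleton γ) _ rfl
  refine ⟨r / 2, half_pos hr, fun z hz => ?_⟩
  by_contra! hlt
  exact hz (h (by rw [Metric.mem_ball, dist_comm]; linarith))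

lemma IsCompatible.continuous_leftMul [CompactSpace M] (hd : IsCompatible d) (g : Γ) :
    Continuous (leftMul g) := by
  refine ⟨fun U hU => ?_⟩
  rw [hd.isOpen_iff] at hU ⊢
  refine ⟨(g : M ≃ₜ M).continuous.isOpen_preimage _ hU.1, fun γ a b hγ h ha => ?_⟩
  exact hU.2 (fun n => g * γ n) _ b ((mul_right_injective g).comp hγ) (h.mul_left g) ha

lemma IsCompatible.continuous_rightMul [CompactSpace M] (hd : IsCompatible d) (g : Γ) :
    Continuous (rightMul g) := by
  refine ⟨fun U hU => ?_⟩
  rw [hd.isOpen_iff] at hU ⊢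
  refine ⟨hU.1, fun γ a b hγ h ha => ?_⟩
  exact hU.2 (fun n => γ n * g) a _ ((mul_left_injective g).comp hγ) (h.mul_right g) ha

lemma IsCompatible.compactSpace [CompactSpace M] (hd : IsCompatible d)
    (hΓ : IsConvergenceGroup Γ) : CompactSpace (GroupUnion Γ) := by
  have := compactSpace_union hΓ
  rwa [← hd] at this

/-- Off the `ε`-ball around `γ⁻¹`, the element `γ` takes values in the `ε`-ball around `γ`. -/
structure IsContracting (ε : ℝ) (γ : Γ) : Prop where
  space : ∀ x : M, ε < dist (ofSpace Γ x) (ofGroup γ⁻¹) →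
    dist (ofSpace Γ ((γ : M ≃ₜ M) x)) (ofGroup γ) < ε
  group : ∀ β : Γ, ε < dist (ofGroup β) (ofGroup γ⁻¹ : GroupUnion Γ) →
    dist (ofGroup (γ * β)) (ofGroup γ : GroupUnion Γ) < ε

/-- If distinct `γ n` converge to `a` off `b`, then `γ n → a` and `(γ n)⁻¹ → b` in `Γ ⊔ M`, so
points far from `(γ n)⁻¹` stay off a neighbourhood of `b`. -/
lemma IsCompatible.eventually_contracting_space [CompactSpace M] (hd : IsCompatible d)
    (hΓ : IsConvergenceGroup Γ) {ε : ℝ} (hε : 0 < ε) :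
    ∀ᶠ γ : Γ in cofinite, ∀ x : M, ε < dist (ofSpace Γ x) (ofGroup γ⁻¹) →
      dist (ofSpace Γ ((γ : M ≃ₜ M) x)) (ofGroup γ) < ε := by
  refine hΓ.eventually_cofinite fun γ a b hγ h => ?_
  have hball : ∀ c : M, {x : M | dist (ofSpace Γ x) (ofSpace Γ c) < ε / 2} ∈ 𝓝 c := fun c =>
    hd.continuous_ofSpace.continuousAt (Metric.ball_mem_nhds _ (half_pos hε))
  have h1 := (hd.tendsto_ofGroup hγ h).eventually (Metric.ball_mem_nhds _ (half_pos hε))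
  have h2 := (hd.tendsto_ofGroup_inv hγ h).eventually (Metric.ball_mem_nhds _ (half_pos hε))
  have h3 := convergesOff_iff.1 h _ (hball a) _ (hball b)
  obtain ⟨n, hn1, hn2, hn3⟩ := (h1.and (h2.and h3)).exists
  refine ⟨n, fun x hx => ?_⟩
  have hxb := hn3 x (fun hx' => by
    have hx' : dist (ofSpace Γ x) (ofSpace Γ b) < ε / 2 := hx'
    have := dist_triangle_right (ofSpace Γ x) (ofGroup (γ n)⁻¹) (ofSpace Γ b)
    linarith)
  have hxb : dist (ofSpace Γ ((γ n : M ≃ₜ M) x)) (ofSpace Γ a) < ε / 2 := hxb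
  have := dist_triangle_right (ofSpace Γ ((γ n : M ≃ₜ M) x)) (ofGroup (γ n)) (ofSpace Γ a)
  linarith

end Metric

lemma ofSpace_injective (Γ : Subgroup (M ≃ₜ M)) : Function.Injective (ofSpace Γ) :=
  Sum.inr_injective

section Separated

variable {Z : Type*} [MetricSpace Z]

lemma exists_separation {q : Fin 3 → Z} (hq : Function.Injective q) :
    ∃ ρ > 0, ∀ i j, i ≠ j → 2 * ρ < dist (q i) (q j) := by
  have : ∀ᶠ ρ in 𝓝[>] (0 : ℝ), ∀ i j, i ≠ j → 2 * ρ < dist (q i) (q j) := by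
    simp only [eventually_all]
    intro i j hij
    have h0 : (0 : ℝ) < dist (q i) (q j) := dist_pos.2 fun h => hij (hq h)
    filter_upwards [Ioo_mem_nhdsGT (half_pos h0)] with ρ hρ
    linarith [hρ.2]
  obtain ⟨ρ, h, hρ⟩ := (this.and self_mem_nhdsWithin).exists
  exact ⟨ρ, hρ, h⟩

/-- By the triangle inequality a closed `ρ`-ball holds at most one of the three points. Two pairs of
indices out of three always meet, so two bad balls can be avoided at once. -/
lemma exists_pair_far {q : Fin 3 → Z} {ρ : ℝ} (hq : ∀ i j, i ≠ j → 2 * ρ < dist (q i) (q j))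
    (z : Z) : ∃ i j, i ≠ j ∧ ρ < dist (q i) z ∧ ρ < dist (q j) z := by
  have key : ∀ i j, i ≠ j → dist (q i) z ≤ ρ → ρ < dist (q j) z := by
    intro i j hij h
    have := dist_triangle_right (q i) (q j) z
    linarith [hq i j hij]
  by_cases h0 : dist (q 0) z ≤ ρ
  · exact ⟨1, 2, by decide, key 0 1 (by decide) h0, key 0 2 (by decide) h0⟩
  · by_cases h1 : dist (q 1) z ≤ ρ
    · exact ⟨0, 2, by decide, not_le.1 h0, key 1 2 (by decide) h1⟩
    · exact ⟨0, 1, by decide, not_le.1 h0, not_le.1 h1⟩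

/-- Two triples of separated points, indexed compatibly, have a common index at which they are far
from two given points. -/
lemma exists_far_far {q r : Fin 3 → Z} {ρ η : ℝ}
    (hq : ∀ i j, i ≠ j → 2 * ρ < dist (q i) (q j)) (hr : ∀ i j, i ≠ j → 2 * η < dist (r i) (r j))
    (z w : Z) : ∃ i, ρ < dist (q i) z ∧ η < dist (r i) w := by
  obtain ⟨i, j, hij, hi, hj⟩ := exists_pair_far hq z
  obtain ⟨k, l, hkl, hk, hl⟩ := exists_pair_far hr w
  rcases common_index i j k l hij hkl with rfl | rfl | rfl | rfl
  exacts [⟨_, hi, hk⟩, ⟨_, hi, hl⟩, ⟨_, hj, hk⟩, ⟨_, hj, hl⟩]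

end Separated

/-! ### Quasi-additivity and properness of magnitudes. -/

section Metric

variable [d : MetricSpace (GroupUnion Γ)]

/-- The contraction on `Γ` is deduced from that on `M`. Outside a finite set `F`, an element `β` is
close to `β (p i)` for at least two of three fixed points. For `f ∈ F` the images `f (p i)` are more
than `2 * η` apart; this handles `β ∈ F`, and excludes `α * β ∈ F` since two images of the `p i`
would be `η`-close to `α`. -/
lemma IsCompatible.eventually_contracting [CompactSpace M] (hd : IsCompatible d)
    (hΓ : IsConvergenceGroup Γ) (hne : IsNonElementary Γ) {ε : ℝ} (hε : 0 < ε) :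
    ∀ᶠ γ : Γ in cofinite, IsContracting ε γ := by
  obtain ⟨p, hp, -⟩ := exists_three_points hne
  obtain ⟨ρ, hρ, hsep⟩ := exists_separation ((ofSpace_injective Γ).comp hp)
  set ε' := min ρ (ε / 2) with hε'
  have hε'0 : 0 < ε' := lt_min hρ (half_pos hε)
  set F : Set Γ := {γ | ¬ ∀ x : M, ε' < dist (ofSpace Γ x) (ofGroup γ⁻¹) →
      dist (ofSpace Γ ((γ : M ≃ₜ M) x)) (ofGroup γ) < ε'} with hF
  have hFfin : F.Finite := hd.eventually_contracting_space hΓ hε'0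
  have hnF : ∀ γ ∉ F, ∀ x : M, ε' < dist (ofSpace Γ x) (ofGroup γ⁻¹) →
      dist (ofSpace Γ ((γ : M ≃ₜ M) x)) (ofGroup γ) < ε' := fun γ hγ => not_not.1 hγ
  have hη : ∀ᶠ η in 𝓝[>] (0 : ℝ), ∀ f ∈ F, ∀ i j, i ≠ j →
      2 * η < dist (ofSpace Γ ((f : M ≃ₜ M) (p i))) (ofSpace Γ ((f : M ≃ₜ M) (p j))) := by
    refine (eventually_all_finite hFfin).2 fun f _ => ?_
    obtain ⟨η, hη, h⟩ := exists_separation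
      ((ofSpace_injective Γ).comp ((f : M ≃ₜ M).injective.comp hp))
    filter_upwards [Ioo_mem_nhdsGT hη] with η' hη' i j hij
    exact lt_trans (by linarith [hη'.2]) (h i j hij)
  obtain ⟨η, hηF, hη0, hηε⟩ := (hη.and (Ioo_mem_nhdsGT (half_pos hε))).exists
  filter_upwards [hd.eventually_contracting_space hΓ hε,
    hd.eventually_contracting_space hΓ hη0] with α hα hαη
  refine ⟨hα, fun β hβ => ?_⟩
  obtain ⟨i, j, hij, hi, hj⟩ : ∃ i j, i ≠ j ∧
      η < dist (ofSpace Γ ((β : M ≃ₜ M) (p i))) (ofGroup α⁻¹) ∧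
      η < dist (ofSpace Γ ((β : M ≃ₜ M) (p j))) (ofGroup α⁻¹) := by
    by_cases hβF : β ∈ F
    · exact exists_pair_far (q := fun i => ofSpace Γ ((β : M ≃ₜ M) (p i))) (hηF β hβF) _
    · obtain ⟨i, j, hij, hi, hj⟩ := exists_pair_far hsep (ofGroup β⁻¹)
      have key : ∀ i, ρ < dist ((ofSpace Γ ∘ p) i) (ofGroup β⁻¹) →
          η < dist (ofSpace Γ ((β : M ≃ₜ M) (p i))) (ofGroup α⁻¹) := by
        intro i hi
        have h1 := hnF β hβF (p i) (lt_of_le_of_lt (min_le_left _ _) hi)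
        have h2 : ε' ≤ ε / 2 := min_le_right _ _
        have := dist_triangle_left (ofGroup β) (ofGroup α⁻¹) (ofSpace Γ ((β : M ≃ₜ M) (p i)))
        linarith
      exact ⟨i, j, hij, key i hi, key j hj⟩
  have hi' := hαη _ hi
  have hj' := hαη _ hj
  by_cases hF' : α * β ∈ F
  · have h1 := hηF _ hF' i j hij
    have := dist_triangle_right (ofSpace Γ ((α : M ≃ₜ M) ((β : M ≃ₜ M) (p i))))
      (ofSpace Γ ((α : M ≃ₜ M) ((β : M ≃ₜ M) (p j)))) (ofGroup α)
    simp only [Subgroup.coe_mul, Homeomorph.mul_apply] at h1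
    linarith
  · obtain ⟨k, hk, hk'⟩ : ∃ k, ρ < dist ((ofSpace Γ ∘ p) k) (ofGroup (α * β)⁻¹) ∧
        dist (ofSpace Γ ((α : M ≃ₜ M) ((β : M ≃ₜ M) (p k)))) (ofGroup α) < η := by
      obtain ⟨k, l, hkl, hk, hl⟩ := exists_pair_far hsep (ofGroup (α * β)⁻¹)
      rcases common_index i j k l hij hkl with rfl | rfl | rfl | rfl
      exacts [⟨_, hk, hi'⟩, ⟨_, hl, hi'⟩, ⟨_, hk, hj'⟩, ⟨_, hl, hj'⟩]
    have h1 := hnF _ hF' (p k) (lt_of_le_of_lt (min_le_left _ _) hk)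
    have h2 : ε' ≤ ε / 2 := min_le_right _ _
    have := dist_triangle_left (ofGroup (α * β)) (ofGroup α)
      (ofSpace Γ ((α : M ≃ₜ M) ((β : M ≃ₜ M) (p k))))
    simp only [Subgroup.coe_mul, Homeomorph.mul_apply] at h1
    linarith

variable {σ : Γ → M → ℝ} {mag : Γ → ℝ}

/-- The bound of quasi-additivity for a fixed right factor. -/
lemma IsCompatible.exists_abs_mag_mul_right_le (hne : IsNonElementary Γ)
    (hσ : IsCoarseCocycle σ) (hmag : IsMagnitude d σ mag) (β : Γ) :
    ∃ C, ∀ α : Γ, |mag (α * β) - mag α - mag β| ≤ C := by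
  obtain ⟨κ, hκ⟩ := hσ
  obtain ⟨p, hp, -⟩ := exists_three_points hne
  obtain ⟨ρ, hρ, hsep⟩ := exists_separation ((ofSpace_injective Γ).comp hp)
  obtain ⟨η, hη, hsep'⟩ := exists_separation
    ((ofSpace_injective Γ).comp ((β : M ≃ₜ M).injective.comp hp))
  obtain ⟨C₁, -, h₁⟩ := hmag ρ hρ
  obtain ⟨C₂, -, h₂⟩ := hmag η hη
  refine ⟨κ + C₁ + C₂ + ((∑ i, |σ β (p i)|) + |mag β|), fun α => ?_⟩
  -- At such an index the cocycle computes both `mag (α * β)` and `mag α`, while `σ β (p i)` takes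
  -- only three values.
  obtain ⟨i, hi, hi'⟩ := exists_far_far hsep hsep' (ofGroup (α * β)⁻¹) (ofGroup α⁻¹)
  have e1 := abs_le.1 (h₁ _ _ hi)
  have e2 := abs_le.1 (h₂ _ _ hi')
  have e3 := abs_le.1 (hκ.cocycle α β (p i))
  have e4 : |σ β (p i)| ≤ ∑ i, |σ β (p i)| :=
    Finset.single_le_sum (f := fun i => |σ β (p i)|) (fun _ _ => abs_nonneg _) (Finset.mem_univ i)
  have e4' := abs_le.1 e4
  have e5 := neg_abs_le (mag β)
  have e6 := le_abs_self (mag β)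
  simp only [Function.comp] at e2
  rw [abs_le]
  constructor <;> linarith [e1.1, e1.2, e2.1, e2.2, e3.1, e3.2, e4'.1, e4'.2]

/-- Magnitudes are quasi-additive on pairs `α`, `β` such that `α⁻¹` and `β` are far apart. -/
lemma IsCompatible.exists_abs_mag_mul_le [CompactSpace M] (hd : IsCompatible d)
    (hΓ : IsConvergenceGroup Γ) (hne : IsNonElementary Γ)
    (hσ : IsCoarseCocycle σ) (hmag : IsMagnitude d σ mag) {ε : ℝ} (hε : 0 < ε) :
    ∃ C, ∀ α β : Γ, ε < dist (ofGroup α⁻¹) (ofGroup β : GroupUnion Γ) →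
      |mag (α * β) - mag α - mag β| ≤ C := by
  obtain ⟨κ, hκ⟩ := id hσ
  obtain ⟨p, hp, -⟩ := exists_three_points hne
  obtain ⟨ρ, hρ, hsep⟩ := exists_separation ((ofSpace_injective Γ).comp hp)
  set ε' := min ρ (ε / 2) with hε'
  have hε'0 : 0 < ε' := lt_min hρ (half_pos hε)
  have hε'2 : ε' ≤ ε / 2 := min_le_right _ _
  obtain ⟨C₁, -, h₁⟩ := hmag ρ hρ
  obtain ⟨C₂, -, h₂⟩ := hmag (ε / 2) (half_pos hε)
  have hfin : {β : Γ | ¬ ∀ x : M, ε' < dist (ofSpace Γ x) (ofGroup β⁻¹) →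
      dist (ofSpace Γ ((β : M ≃ₜ M) x)) (ofGroup β) < ε'}.Finite :=
    hd.eventually_contracting_space hΓ hε'0
  choose C₃ h₃ using exists_abs_mag_mul_right_le hne hσ hmag
  obtain ⟨C₄, h₄⟩ := (hfin.image C₃).bddAbove
  refine ⟨max C₄ (κ + C₁ + C₁ + C₂), fun α β hαβ => ?_⟩
  -- A contracting `β` moves `p i` close to `β`, hence away from `α⁻¹`. The finitely many other `β`
  -- are covered by the bound for a fixed right factor.
  by_cases hβ : ∀ x : M, ε' < dist (ofSpace Γ x) (ofGroup β⁻¹) →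
      dist (ofSpace Γ ((β : M ≃ₜ M) x)) (ofGroup β) < ε'
  · refine le_trans ?_ (le_max_right _ _)
    obtain ⟨i, hi, hi'⟩ := exists_far_far hsep hsep (ofGroup (α * β)⁻¹) (ofGroup β⁻¹)
    have h := hβ (p i) (lt_of_le_of_lt (min_le_left _ _) hi')
    have hfar : ε / 2 < dist (ofSpace Γ ((β : M ≃ₜ M) (p i))) (ofGroup α⁻¹) := by
      have := dist_triangle_left (ofGroup α⁻¹) (ofGroup β) (ofSpace Γ ((β : M ≃ₜ M) (p i)))
      linarith
    have e1 := abs_le.1 (h₁ _ _ hi)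
    have e2 := abs_le.1 (h₂ _ _ hfar)
    have e3 := abs_le.1 (hκ.cocycle α β (p i))
    have e4 := abs_le.1 (h₁ _ _ hi')
    rw [abs_le]
    constructor <;> linarith [e1.1, e1.2, e2.1, e2.2, e3.1, e3.2, e4.1, e4.2]
  · exact (h₃ β α).trans ((h₄ ⟨β, hβ, rfl⟩).trans (le_max_left _ _))

/-- The point `g⁻¹` is isolated in `Γ ⊔ M`, so every other `γ` is at a definite distance from it and
quasi-additivity applies. -/
lemma IsCompatible.exists_abs_mag_mul_left_le [CompactSpace M] (hd : IsCompatible d)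
    (hΓ : IsConvergenceGroup Γ) (hne : IsNonElementary Γ)
    (hσ : IsCoarseCocycle σ) (hmag : IsMagnitude d σ mag) (g : Γ) :
    ∃ C, ∀ γ : Γ, |mag (g * γ) - mag γ| ≤ C := by
  obtain ⟨r, hr, h⟩ := hd.exists_isolated g⁻¹
  obtain ⟨C, hC⟩ := hd.exists_abs_mag_mul_le hΓ hne hσ hmag hr
  refine ⟨max (C + |mag g|) |mag 1 - mag g⁻¹|, fun γ => ?_⟩
  by_cases hγ : γ = g⁻¹
  · subst hγ
    simp
  · refine le_trans ?_ (le_max_left _ _)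
    have e1 := abs_le.1 (hC g γ (h _ fun h' => hγ (Sum.inl_injective h')))
    have e5 := neg_abs_le (mag g)
    have e6 := le_abs_self (mag g)
    rw [abs_le]
    constructor <;> linarith [e1.1, e1.2]

/-- Eventually `γ n` is loxodromic with fixed points near `a` and `b`, so properness applies. The
attracting point is far from `(γ n)⁻¹`, which is near `b`; hence the cocycle there agrees with the
magnitude up to a constant. -/
lemma IsExpanding.tendsto_mag_of_ne [CompactSpace M] (hd : IsCompatible d)
    (hΓ : IsConvergenceGroup Γ) (hne : IsNonElementary Γ) (hσ : IsExpanding d σ mag)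
    {γ : ℕ → Γ} {a b : M} (hγ : Function.Injective γ)
    (h : ConvergesOff (fun n => (γ n : M ≃ₜ M)) a b) (hab : a ≠ b) :
    Tendsto (fun n => mag (γ n)) atTop atTop := by
  set r := dist (ofSpace Γ a) (ofSpace Γ b) / 4 with hr
  have hr0 : 0 < r := div_pos (dist_pos.2 fun h => hab (ofSpace_injective Γ h)) (by norm_num)
  have hball : ∀ c : M, {x : M | dist (ofSpace Γ x) (ofSpace Γ c) < r} ∈ 𝓝 c := fun c =>
    hd.continuous_ofSpace.continuousAt (Metric.ball_mem_nhds _ hr0)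
  have h2 := (hd.tendsto_ofGroup_inv hγ h).eventually (Metric.ball_mem_nhds _ hr0)
  obtain ⟨N, hN⟩ := eventually_atTop.1
    ((eventually_isLoxodromic hΓ hne h hab (hball a) (hball b)).and h2)
  have hN1 := fun n => (hN (n + N) (Nat.le_add_left N n)).1
  have hN2 := fun n => (hN (n + N) (Nat.le_add_left N n)).2
  choose p hp q hq hl using hN1
  have hp : ∀ n, dist (ofSpace Γ (p n)) (ofSpace Γ a) < r := hp
  have hq : ∀ n, dist (ofSpace Γ (q n)) (ofSpace Γ b) < r := hq
  have hab' : dist (ofSpace Γ a) (ofSpace Γ b) = 4 * r := by rw [hr]; ring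
  have hprop := hσ.proper (fun n => γ (n + N)) p q
    (hγ.comp (add_left_injective N)) hl (by
      refine lt_of_lt_of_le (EReal.coe_pos.2 hr0) (le_liminf_of_le (by isBoundedDefault)
        (Eventually.of_forall fun n => EReal.coe_le_coe_iff.2 ?_))
      have h1 := dist_triangle4 (ofSpace Γ a) (ofSpace Γ (p n)) (ofSpace Γ (q n)) (ofSpace Γ b)
      have h2 := dist_comm (ofSpace Γ a) (ofSpace Γ (p n))
      have h3 := dist_comm (ofSpace Γ (q n)) (ofSpace Γ (p n))
      linarith [hp n, hq n])
  obtain ⟨C, -, hC⟩ := hσ.magnitude r hr0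
  rw [← tendsto_add_atTop_iff_nat N]
  refine tendsto_atTop_mono (fun n => ?_) (tendsto_atTop_add_const_right _ (-C) hprop)
  have := abs_le.1 (hC (p n) (γ (n + N)) (by
    have h1 := dist_triangle4 (ofSpace Γ a) (ofSpace Γ (p n)) (ofGroup (γ (n + N))⁻¹) (ofSpace Γ b)
    have h2 := dist_comm (ofSpace Γ a) (ofSpace Γ (p n))
    have h3 := hN2 n
    change r < dist (ofSpace Γ (p n)) (ofGroup (γ (n + N))⁻¹)
    linarith [hp n]))
  linarith [this.2]

/-- Magnitudes are proper functions on `Γ`. -/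
lemma IsExpanding.tendsto_mag [CompactSpace M] (hd : IsCompatible d)
    (hΓ : IsConvergenceGroup Γ) (hne : IsNonElementary Γ) (hσ : IsExpanding d σ mag) :
    Tendsto mag cofinite atTop := by
  refine tendsto_atTop.2 fun R => hΓ.eventually_cofinite fun γ a b hγ h => ?_
  -- If `a = b`, left translation by an element that moves `a` separates the two points and changes
  -- magnitudes by a bounded amount.
  by_cases hab : a = b
  · subst hab
    obtain ⟨g, hg⟩ := exists_apply_ne hΓ hne a
    obtain ⟨C, hC⟩ := hd.exists_abs_mag_mul_left_le hΓ hne hσ.coarseCocycle hσ.magnitude g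
    have := hσ.tendsto_mag_of_ne hd hΓ hne ((mul_right_injective g).comp hγ)
      (h.mul_left (g : M ≃ₜ M)) hg
    obtain ⟨n, hn⟩ := (this.eventually_ge_atTop (R + C)).exists
    refine ⟨n, ?_⟩
    have h1 := (abs_le.1 (hC (γ n))).2
    simp only [Function.comp] at hn
    linarith
  · exact ((hσ.tendsto_mag_of_ne hd hΓ hne hγ h hab).eventually_ge_atTop R).exists

end Metric

end BishopJones

/-! ### Poincaré series, critical exponents and word length on free semigroups. -/

namespace BishopJones

section Poincare

variable {G : Type*} {mag : G → ℝ} {s : ℝ}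

lemma poincareSeries_mono {H H' : Set G} (h : H ⊆ H') :
    poincareSeries mag H s ≤ poincareSeries mag H' s :=
  ENNReal.tsum_mono_subtype (fun γ => ENNReal.ofReal (Real.exp (-s * mag γ))) h

lemma poincareSeries_union_le (H H' : Set G) :
    poincareSeries mag (H ∪ H') s ≤ poincareSeries mag H s + poincareSeries mag H' s :=
  ENNReal.tsum_union_le (fun γ => ENNReal.ofReal (Real.exp (-s * mag γ))) H H'

lemma poincareSeries_le_of_finite {H : Set G} (hH : H.Finite) {c : ℝ}
    (hc : ∀ γ ∈ H, Real.exp (-s * mag γ) ≤ c) :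
    poincareSeries mag H s ≤ H.ncard * ENNReal.ofReal c := by
  have := hH.fintype
  unfold poincareSeries
  rw [tsum_fintype, ← Nat.card_coe_set_eq, Nat.card_eq_fintype_card, ← Finset.card_univ,
    ← nsmul_eq_mul]
  exact Finset.sum_le_card_nsmul _ _ _ fun γ _ => ENNReal.ofReal_le_ofReal (hc γ γ.2)

lemma poincareSeries_lt_top_of_finite {H : Set G} (hH : H.Finite) :
    poincareSeries mag H s < ⊤ := by
  have := hH.fintype
  unfold poincareSeries
  rw [tsum_fintype]
  exact ENNReal.sum_lt_top.2 fun _ _ => ENNReal.ofReal_lt_top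

lemma poincareSeries_eq_top_of_lt {H : Set G} (hs : 0 < s)
    (h : ENNReal.ofReal s < criticalExponent mag H) : poincareSeries mag H s = ⊤ := by
  by_contra hne
  exact absurd h (not_lt.2 (sInf_le ⟨s, hs, lt_top_iff_ne_top.2 hne, rfl⟩))

/-- A geometric series of exponentials is finite. -/
lemma tsum_ofReal_exp_lt_top {a b : ℝ} (ha : a < 0) :
    ∑' n : ℕ, ENNReal.ofReal (Real.exp (a * n + b)) < ⊤ := by
  have : ∀ n : ℕ, ENNReal.ofReal (Real.exp (a * n + b)) =
      ENNReal.ofReal (Real.exp b) * ENNReal.ofReal (Real.exp a) ^ n := by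
    intro n
    rw [← ENNReal.ofReal_pow (Real.exp_pos _).le, ← ENNReal.ofReal_mul (Real.exp_pos _).le,
      ← Real.exp_nat_mul, ← Real.exp_add]
    ring_nf
  simp only [this]
  rw [ENNReal.tsum_mul_left, ENNReal.tsum_geometric]
  refine ENNReal.mul_lt_top ENNReal.ofReal_lt_top (ENNReal.inv_lt_top.2 ?_)
  rw [tsub_pos_iff_lt, ENNReal.ofReal_lt_one]
  exact Real.exp_lt_one_iff.2 ha

/-- If the Poincaré series diverges at `s`, then there are shells that contain exponentially many
elements, at each rate less than `s`. -/
lemma exists_large_shell (hmag : Tendsto mag cofinite atTop) {H : Set G} {t : ℝ} (hs : 0 ≤ s)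
    (hts : t < s) (hH : poincareSeries mag H s = ⊤) (N : ℕ) :
    ∃ n ≥ N, Real.exp (t * n) ≤ ({γ ∈ H | (n : ℝ) ≤ mag γ ∧ mag γ < n + 1}.ncard : ℝ) := by
  -- If all shells from `N` on are small, they contribute at most a geometric series of ratio `e^{t
  -- - s}`, and only finitely many elements lie below `N`.
  by_contra! h
  have hfin : ∀ R : ℝ, {γ | mag γ < R}.Finite := fun R => by
    simpa using (hmag.eventually_ge_atTop R)
  let E : ℕ → Set G := fun n => {γ ∈ H | (n : ℝ) ≤ mag γ ∧ mag γ < n + 1}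
  have hEfin : ∀ n, (E n).Finite := fun n => (hfin (n + 1)).subset fun γ hγ => hγ.2.2
  have hE : ∀ n ≥ N, poincareSeries mag (E n) s ≤ ENNReal.ofReal (Real.exp ((t - s) * n + 0)) := by
    intro n hn
    refine (poincareSeries_le_of_finite (hEfin n) (c := Real.exp (-s * n)) fun γ hγ => ?_).trans ?_
    · refine Real.exp_le_exp.2 ?_
      rw [neg_mul, neg_mul]
      exact neg_le_neg (mul_le_mul_of_nonneg_left hγ.2.1 hs)
    · rw [← ENNReal.ofReal_natCast, ← ENNReal.ofReal_mul (Nat.cast_nonneg _)]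
      refine ENNReal.ofReal_le_ofReal ?_
      have : Real.exp ((t - s) * n + 0) = Real.exp (t * n) * Real.exp (-s * n) := by
        rw [← Real.exp_add]; ring_nf
      rw [this]
      exact mul_le_mul_of_nonneg_right (h n hn).le (Real.exp_pos _).le
  have hcover : H ⊆ {γ | mag γ < N} ∪ ⋃ i : ℕ, E (i + N) := by
    intro γ hγ
    by_cases hlt : mag γ < N
    · exact Or.inl hlt
    · have h0 : (0 : ℝ) ≤ mag γ := (Nat.cast_nonneg N).trans (not_lt.1 hlt)
      have hN : N ≤ ⌊mag γ⌋₊ := Nat.le_floor (not_lt.1 hlt)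
      refine Or.inr (mem_iUnion.2 ⟨⌊mag γ⌋₊ - N, ?_⟩)
      rw [Nat.sub_add_cancel hN]
      exact ⟨hγ, Nat.floor_le h0, Nat.lt_floor_add_one _⟩
  have hlt : poincareSeries mag H s < ⊤ := by
    refine (poincareSeries_mono hcover).trans_lt ((poincareSeries_union_le _ _).trans_lt ?_)
    refine ENNReal.add_lt_top.2 ⟨poincareSeries_lt_top_of_finite (hfin N), ?_⟩
    refine (ENNReal.tsum_iUnion_le_tsum (fun γ => ENNReal.ofReal (Real.exp (-s * mag γ)))
      fun i => E (i + N)).trans_lt ?_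
    refine lt_of_le_of_lt (ENNReal.tsum_le_tsum fun i => hE (i + N) (Nat.le_add_left N i)) ?_
    have := tsum_ofReal_exp_lt_top (a := t - s) (b := (t - s) * N) (sub_neg.2 hts)
    refine lt_of_eq_of_lt (tsum_congr fun i => ?_) this
    push_cast
    ring_nf
  exact hlt.ne hH

end Poincare

section Free

variable {G : Type*} [Group G] {S : Finset G} {mag : G → ℝ}

lemma isFreeOn_iff : IsFreeOn S ↔ ∀ l l' : List G, (∀ g ∈ l, g ∈ S) → (∀ g ∈ l', g ∈ S) →
    l.prod = l'.prod → l = l' := by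
  constructor
  · intro h l l' hl hl' hEq
    lift l to List S using hl
    lift l' to List S using hl'
    have := @h (FreeMonoid.ofList l) (FreeMonoid.ofList l') (by
      simpa [FreeMonoid.lift_ofList] using hEq)
    rw [FreeMonoid.ofList.injective this]
  · intro h a b hab
    rw [FreeMonoid.lift_apply, FreeMonoid.lift_apply] at hab
    have := h _ _ (by simp +contextual) (by simp +contextual) hab
    exact FreeMonoid.toList.injective (List.map_injective_iff.2 Subtype.val_injective this)

lemma IsFreeOn.wordLength_prod (h : IsFreeOn S) {l : List G} (hl : ∀ g ∈ l, g ∈ S) :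
    wordLength S l.prod = l.length := by
  have : {k | ∃ w : List G, w.length = k ∧ (∀ g ∈ w, g ∈ S) ∧ w.prod = l.prod} = {l.length} := by
    ext k
    constructor
    · rintro ⟨w, rfl, hw, hEq⟩
      rw [isFreeOn_iff.1 h w l hw hl hEq]; rfl
    · rintro rfl
      exact ⟨l, rfl, hl, rfl⟩
  rw [wordLength, this, csInf_singleton]

lemma mem_closure_iff_exists_list {γ : G} :
    γ ∈ Submonoid.closure (S : Set G) ↔ ∃ l : List G, (∀ g ∈ l, g ∈ S) ∧ l.prod = γ := by
  constructor
  · intro h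
    obtain ⟨l, hl, rfl⟩ := Submonoid.exists_list_of_mem_closure h
    exact ⟨l, fun g hg => hl g hg, rfl⟩
  · rintro ⟨l, hl, rfl⟩
    exact Submonoid.list_prod_mem _ fun g hg => Submonoid.subset_closure (hl g hg)

/-- Words in `S`, as elements of the semigroup. -/
def wordProd (S : Finset G) (w : Σ m : ℕ, (Fin m → S)) : (Submonoid.closure (S : Set G) : Set G) :=
  ⟨(List.ofFn fun i => (w.2 i : G)).prod, mem_closure_iff_exists_list.2
    ⟨_, by simp [List.mem_ofFn], rfl⟩⟩

lemma wordProd_surjective (S : Finset G) : Function.Surjective (wordProd S) := by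
  rintro ⟨γ, hγ⟩
  obtain ⟨l, hl, rfl⟩ := mem_closure_iff_exists_list.1 hγ
  refine ⟨⟨l.length, fun i => ⟨l.get i, hl _ (List.get_mem _ _)⟩⟩, Subtype.ext ?_⟩
  change (List.ofFn l.get).prod = l.prod
  rw [List.ofFn_get]

lemma IsFreeOn.wordProd_injective (h : IsFreeOn S) (m : ℕ) :
    Function.Injective fun f : Fin m → S => wordProd S ⟨m, f⟩ := by
  intro f f' hEq
  have := isFreeOn_iff.1 h _ _ (by simp [List.mem_ofFn]) (by simp [List.mem_ofFn])
    (congrArg Subtype.val hEq)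
  exact funext fun i => Subtype.ext (congrFun (List.ofFn_injective this) i)

/-- For `s > log(#S) / A` the sum over all words is dominated by a geometric series. Freeness is not
needed: words surject onto the semigroup. -/
lemma criticalExponent_le_of_words {A A₀ : ℝ} (hA : 0 < A)
    (h : ∀ l : List G, (∀ g ∈ l, g ∈ S) → A * l.length - A₀ ≤ mag l.prod) :
    criticalExponent mag (Submonoid.closure (S : Set G) : Set G) ≤
      ENNReal.ofReal (Real.log S.card / A) := by
  have hlog : 0 ≤ Real.log S.card := Real.log_natCast_nonneg _
  have key : ∀ s : ℝ, Real.log S.card / A < s →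
      criticalExponent mag (Submonoid.closure (S : Set G) : Set G) ≤ ENNReal.ofReal s := by
    intro s hs
    have hs0 : 0 < s := (div_nonneg hlog hA.le).trans_lt hs
    refine sInf_le ⟨s, hs0, ?_, rfl⟩
    unfold poincareSeries
    refine (ENNReal.tsum_le_tsum_comp_of_surjective (wordProd_surjective S) _).trans_lt ?_
    have hneg : Real.log S.card - s * A < 0 := by
      rw [div_lt_iff₀ hA] at hs; linarith
    refine lt_of_le_of_lt ?_ (tsum_ofReal_exp_lt_top (b := s * A₀) hneg)
    rw [ENNReal.tsum_sigma (fun m f =>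
      ENNReal.ofReal (Real.exp (-s * mag (wordProd S ⟨m, f⟩ : G))))]
    refine ENNReal.tsum_le_tsum fun m => ?_
    have hle : ∀ f : Fin m → S, ENNReal.ofReal (Real.exp (-s * mag (wordProd S ⟨m, f⟩ : G))) ≤
        ENNReal.ofReal (Real.exp (-s * (A * m - A₀))) := by
      intro f
      refine ENNReal.ofReal_le_ofReal (Real.exp_le_exp.2 ?_)
      have := h (List.ofFn fun i => (f i : G)) (by simp [List.mem_ofFn])
      rw [List.length_ofFn] at this
      rw [neg_mul, neg_mul]
      exact neg_le_neg (mul_le_mul_of_nonneg_left this hs0.le)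
    refine (ENNReal.tsum_le_tsum hle).trans ?_
    rw [tsum_fintype, Finset.sum_const, Finset.card_univ, Fintype.card_fun, Fintype.card_fin,
      Fintype.card_coe, nsmul_eq_mul, ← ENNReal.ofReal_natCast,
      ← ENNReal.ofReal_mul (Nat.cast_nonneg _)]
    refine ENNReal.ofReal_le_ofReal ?_
    -- For empty `S` the convention `log 0 = 0` makes the right side 1, which is attained at `m =
    -- 0`.
    have h1 : ((S.card ^ m : ℕ) : ℝ) ≤ Real.exp (Real.log S.card * m) := by
      rcases Nat.eq_zero_or_pos S.card with h0 | h0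
      · rw [h0]
        rcases Nat.eq_zero_or_pos m with rfl | hm
        · simp
        · simp [hm.ne']
      · rw [mul_comm, Real.exp_nat_mul, Real.exp_log (by exact_mod_cast h0)]
        push_cast
        exact le_rfl
    refine (mul_le_mul_of_nonneg_right h1 (Real.exp_pos _).le).trans_eq ?_
    rw [← Real.exp_add]
    ring_nf
  refine ENNReal.le_of_forall_pos_le_add fun ε hε _ => ?_
  have h0 := key (Real.log S.card / A + ε) (lt_add_of_pos_right _ (NNReal.coe_pos.2 hε))
  rwa [ENNReal.ofReal_add (div_nonneg hlog hA.le) ε.coe_nonneg, ENNReal.ofReal_coe_nnreal] at h0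

/-- By freeness the `(#S)^m` words of length `m` are distinct elements. For `s < log(#S) / A` their
contribution is unbounded in `m`. -/
lemma IsFreeOn.le_criticalExponent_of_words (hS : IsFreeOn S) {A A₀ : ℝ} (hA : 0 < A)
    (h : ∀ l : List G, (∀ g ∈ l, g ∈ S) → mag l.prod ≤ A * l.length + A₀) :
    ENNReal.ofReal (Real.log S.card / A) ≤
      criticalExponent mag (Submonoid.closure (S : Set G) : Set G) := by
  refine le_sInf ?_
  rintro _ ⟨s, hs, hfin, rfl⟩
  refine ENNReal.ofReal_le_ofReal ?_
  by_contra! hlt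
  have hpos : 0 < Real.log S.card - s * A := by
    rw [lt_div_iff₀ hA] at hlt; linarith
  have hcard : 0 < S.card := by
    rcases Nat.eq_zero_or_pos S.card with h0 | h0
    · rw [h0, Nat.cast_zero, Real.log_zero] at hpos
      have := mul_pos hs hA
      linarith
    · exact h0
  have hle : ∀ m : ℕ, ENNReal.ofReal (Real.exp ((Real.log S.card - s * A) * m - s * A₀)) ≤
      poincareSeries mag (Submonoid.closure (S : Set G) : Set G) s := by
    intro m
    refine le_trans ?_ (ENNReal.tsum_comp_le_tsum_of_injective (hS.wordProd_injective m) _)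
    have hle : ∀ f : Fin m → S, ENNReal.ofReal (Real.exp (-s * (A * m + A₀))) ≤
        ENNReal.ofReal (Real.exp (-s * mag (wordProd S ⟨m, f⟩ : G))) := by
      intro f
      refine ENNReal.ofReal_le_ofReal (Real.exp_le_exp.2 ?_)
      have := h (List.ofFn fun i => (f i : G)) (by simp [List.mem_ofFn])
      rw [List.length_ofFn] at this
      rw [neg_mul, neg_mul]
      exact neg_le_neg (mul_le_mul_of_nonneg_left this hs.le)
    refine le_trans ?_ (ENNReal.tsum_le_tsum hle)
    rw [tsum_fintype, Finset.sum_const, Finset.card_univ, Fintype.card_fun, Fintype.card_fin,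
      Fintype.card_coe, nsmul_eq_mul, ← ENNReal.ofReal_natCast,
      ← ENNReal.ofReal_mul (Nat.cast_nonneg _)]
    refine ENNReal.ofReal_le_ofReal (le_of_eq ?_)
    have h1 : ((S.card ^ m : ℕ) : ℝ) = Real.exp (Real.log S.card * m) := by
      rw [mul_comm, Real.exp_nat_mul, Real.exp_log (by exact_mod_cast hcard)]
      push_cast
      rfl
    rw [h1, ← Real.exp_add]
    ring_nf
  have htop : Tendsto (fun m : ℕ => Real.exp ((Real.log S.card - s * A) * m - s * A₀)) atTop atTop :=
    Real.tendsto_exp_atTop.comp (tendsto_atTop_add_const_right _ _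
      (tendsto_natCast_atTop_atTop.const_mul_atTop hpos))
  obtain ⟨m, hm⟩ := (htop.eventually_gt_atTop
    (poincareSeries mag (Submonoid.closure (S : Set G) : Set G) s).toReal).exists
  have := hle m
  rw [ENNReal.ofReal_le_iff_le_toReal hfin.ne] at this
  linarith

/-- On a free semigroup, a proper quasi-additive function is comparable to the word length. -/
lemma IsFreeOn.coarselyBiLipschitzOn_wordLength (hS : IsFreeOn S)
    (hmag : Tendsto mag cofinite atTop) {C : ℝ}
    (hC : ∀ l l' : List G, (∀ g ∈ l, g ∈ S) → (∀ g ∈ l', g ∈ S) →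
      |mag (l.prod * l'.prod) - mag l.prod - mag l'.prod| ≤ C) :
    ∃ B b : ℝ, 1 < B ∧ 0 < b ∧
      CoarselyBiLipschitzOn (Submonoid.closure (S : Set G) : Set G) B b
        (fun γ => (wordLength S γ : ℝ)) mag := by
  have hfin : ∀ R : ℝ, {γ | mag γ < R}.Finite := fun R => by
    simpa using (hmag.eventually_ge_atTop R)
  obtain ⟨C₀, hC₀⟩ : ∃ C₀, ∀ γ, -C₀ ≤ mag γ := by
    obtain ⟨r, hr⟩ := ((hfin 0).image mag).bddBelow
    refine ⟨|r|, fun γ => ?_⟩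
    by_cases h : mag γ < 0
    · exact (neg_abs_le r).trans (hr ⟨γ, h, rfl⟩)
    · exact (neg_nonpos.2 (abs_nonneg r)).trans (not_lt.1 h)
  -- Only finitely many elements have magnitude below `C + 1`; `k` exceeds all their word lengths.
  obtain ⟨k, hk0, hk⟩ : ∃ k : ℕ, 0 < k ∧ ∀ l : List G, (∀ g ∈ l, g ∈ S) → l.length = k →
      C + 1 ≤ mag l.prod := by
    obtain ⟨K, hK⟩ := ((hfin (C + 1)).image (wordLength S)).bddAbove
    refine ⟨K + 1, K.succ_pos, fun l hl hlen => ?_⟩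
    by_contra! hlt
    have := hK ⟨l.prod, hlt, rfl⟩
    rw [hS.wordLength_prod hl, hlen] at this
    omega
  have hkR : (0 : ℝ) < k := by exact_mod_cast hk0
  have hlow : ∀ n : ℕ, ∀ l : List G, (∀ g ∈ l, g ∈ S) → l.length = n →
      (n : ℝ) / k - 1 - C₀ ≤ mag l.prod := by
    intro n
    induction n using Nat.strong_induction_on with
    | _ n ih =>
      intro l hl hlen
      by_cases hn : n < k
      · have : (n : ℝ) / k < 1 := (div_lt_one hkR).2 (by exact_mod_cast hn)
        linarith [hC₀ l.prod]
      · have hl1 : ∀ g ∈ l.take k, g ∈ S := fun g hg => hl g (List.mem_of_mem_take hg)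
        have hl2 : ∀ g ∈ l.drop k, g ∈ S := fun g hg => hl g (List.mem_of_mem_drop hg)
        have h1 := hk _ hl1 (by rw [List.length_take, hlen]; omega)
        have h2 := ih (n - k) (by omega) _ hl2 (by rw [List.length_drop, hlen])
        have h3 := (abs_le.1 (hC _ _ hl1 hl2)).1
        rw [List.prod_take_mul_prod_drop] at h3
        rw [Nat.cast_sub (not_lt.1 hn), sub_div, div_self hkR.ne'] at h2
        linarith
  set D : ℝ := ∑ g ∈ S, |mag g| with hD
  have hD0 : 0 ≤ D := Finset.sum_nonneg fun _ _ => abs_nonneg _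
  have hup : ∀ l : List G, (∀ g ∈ l, g ∈ S) → mag l.prod ≤ (D + |C|) * l.length + |mag 1| := by
    intro l
    induction l with
    | nil => intro _; simpa using le_abs_self _
    | cons g l ih =>
      intro hl
      have h1 := ih fun g' hg' => hl g' (List.mem_cons_of_mem _ hg')
      have h2 := (abs_le.1 (hC [g] l (by simpa using hl g List.mem_cons_self)
        fun g' hg' => hl g' (List.mem_cons_of_mem _ hg'))).2
      have h3 : |mag g| ≤ D := Finset.single_le_sum (f := fun g => |mag g|)
        (fun _ _ => abs_nonneg _) (hl g List.mem_cons_self)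
      have h4 := le_abs_self (mag g)
      have h5 := le_abs_self C
      rw [List.prod_singleton] at h2
      rw [List.prod_cons, List.length_cons]
      push_cast
      linarith
  refine ⟨D + |C| + k + 1, |C₀| + 1 + |mag 1|, by linarith [abs_nonneg C],
    by linarith [abs_nonneg C₀, abs_nonneg (mag 1)], fun γ hγ => ?_⟩
  obtain ⟨l, hl, rfl⟩ := mem_closure_iff_exists_list.1 hγ
  beta_reduce
  rw [hS.wordLength_prod hl]
  have hlen : (0 : ℝ) ≤ l.length := Nat.cast_nonneg _
  constructor
  · have h1 := hlow _ l hl rfl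
    have h2 : 1 / (D + |C| + k + 1) * (l.length : ℝ) ≤ l.length / k := by
      rw [one_div_mul_eq_div]
      exact div_le_div_of_nonneg_left hlen hkR (by linarith [abs_nonneg C])
    linarith [le_abs_self C₀, abs_nonneg (mag 1)]
  · have h1 := hup l hl
    have h2 : 0 ≤ (k + 1 : ℝ) * l.length := by positivity
    have h3 : (D + |C| + k + 1) * (l.length : ℝ) = (D + |C|) * l.length + (k + 1) * l.length := by
      ring
    linarith [abs_nonneg C₀]

end Free

lemma CoarselyBiLipschitzOn.trans {G : Type*} {H : Set G} {B B' b b' : ℝ} {f g g' : G → ℝ}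
    (hB : 1 < B) (hb : 0 < b) (hB' : 1 < B') (hb' : 0 < b')
    (h : CoarselyBiLipschitzOn H B b f g) (h' : CoarselyBiLipschitzOn H B' b' f g') :
    ∃ B₂ b₂ : ℝ, 1 < B₂ ∧ 0 < b₂ ∧ CoarselyBiLipschitzOn H B₂ b₂ g' g := by
  have hB0 : 0 < B := one_pos.trans hB
  have hB0' : 0 < B' := one_pos.trans hB'
  refine ⟨B * B', B * B' * b' + b, one_lt_mul_of_lt_of_le hB hB'.le, by positivity, fun γ hγ => ?_⟩
  obtain ⟨h1, h2⟩ := h γ hγ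
  obtain ⟨h3, h4⟩ := h' γ hγ
  constructor
  · have h5 : 1 / (B * B') * g' γ ≤ 1 / (B * B') * (B' * f γ + b') :=
      mul_le_mul_of_nonneg_left h4 (by positivity)
    have h6 : 1 / (B * B') * (B' * f γ + b') = 1 / B * f γ + 1 / (B * B') * b' := by
      field_simp
    have h7 : 1 / (B * B') * b' ≤ B * B' * b' := by
      refine mul_le_mul_of_nonneg_right ?_ hb'.le
      have : 1 ≤ B * B' := (one_lt_mul_of_lt_of_le hB hB'.le).le
      exact ((div_le_one (by positivity)).2 this).trans this
    linarith
  · have h5 : B * B' * (1 / B' * f γ - b') ≤ B * B' * g' γ :=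
      mul_le_mul_of_nonneg_left h3 (by positivity)
    have h6 : B * B' * (1 / B' * f γ - b') = B * f γ - B * B' * b' := by
      field_simp
    linarith

end BishopJones

/-! ### Localization of divergence and ping-pong. -/

namespace BishopJones

variable {M : Type*} [MetricSpace M] {Γ : Subgroup (M ≃ₜ M)}

section Metric

variable [d : MetricSpace (GroupUnion Γ)] {σ : Γ → M → ℝ} {mag : Γ → ℝ}

/-- A divergent Poincaré series diverges near a pair of points of `M`. -/
lemma IsCompatible.exists_localized [CompactSpace M] (hd : IsCompatible d)
    (hΓ : IsConvergenceGroup Γ) {s : ℝ} (h : poincareSeries mag univ s = ⊤) :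
    ∃ u v : M, ∀ W ∈ 𝓝 (ofSpace Γ u, ofSpace Γ v),
      poincareSeries mag {γ : Γ | (ofGroup γ, ofGroup γ⁻¹) ∈ W} s = ⊤ := by
  -- Convergence passes to finite unions, so by compactness it is enough to have it locally. A pair
  -- with a coordinate in the discrete part has a neighbourhood that contains at most one `(γ,
  -- γ⁻¹)`.
  by_contra! hcon
  have := hd.compactSpace hΓ
  have huniv : poincareSeries mag
      {γ : Γ | ((ofGroup γ, ofGroup γ⁻¹) : GroupUnion Γ × GroupUnion Γ) ∈ univ} s < ⊤ := by
    refine isCompact_univ.induction_on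
      (p := fun W => poincareSeries mag {γ : Γ | (ofGroup γ, ofGroup γ⁻¹) ∈ W} s < ⊤) ?_ ?_ ?_ ?_
    · exact poincareSeries_lt_top_of_finite (by simp)
    · intro W W' hWW' hW'
      refine lt_of_le_of_lt (poincareSeries_mono ?_) hW'
      exact fun γ hγ => hWW' hγ
    · intro W W' hW hW'
      exact (poincareSeries_union_le _ _).trans_lt (ENNReal.add_lt_top.2 ⟨hW, hW'⟩)
    · rintro ⟨z, w⟩ -
      rw [nhdsWithin_univ]
      rcases z with g | u
      · refine ⟨{ofGroup g} ×ˢ univ, prod_mem_nhds ((hd.isOpen_singleton g).mem_nhds rfl)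
          univ_mem, poincareSeries_lt_top_of_finite ((finite_singleton g).subset fun γ hγ => ?_)⟩
        exact Sum.inl_injective hγ.1
      rcases w with g | v
      · refine ⟨univ ×ˢ {ofGroup g}, prod_mem_nhds univ_mem ((hd.isOpen_singleton g).mem_nhds rfl),
          poincareSeries_lt_top_of_finite ((finite_singleton g⁻¹).subset fun γ hγ => ?_)⟩
        have : γ⁻¹ = g := Sum.inl_injective hγ.2
        rw [mem_singleton_iff, ← this, inv_inv]
      · obtain ⟨W, hW, hWs⟩ := hcon u v
        exact ⟨W, hW, lt_top_iff_ne_top.2 hWs⟩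
  simp only [mem_univ, ofPred_true] at huniv
  exact huniv.ne h

/-- The two points at which a divergent Poincaré series localizes can be chosen distinct. -/
lemma IsExpanding.exists_localized_ne [CompactSpace M] (hd : IsCompatible d)
    (hΓ : IsConvergenceGroup Γ) (hne : IsNonElementary Γ) (hσ : IsExpanding d σ mag)
    {s : ℝ} (hs : 0 ≤ s) (h : poincareSeries mag univ s = ⊤) :
    ∃ u v : M, u ≠ v ∧ ∀ W ∈ 𝓝 (ofSpace Γ u, ofSpace Γ v),
      poincareSeries mag {γ : Γ | (ofGroup γ, ofGroup γ⁻¹) ∈ W} s = ⊤ := by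
  obtain ⟨u, v, huv⟩ := hd.exists_localized hΓ h
  by_cases hEq : u = v
  swap
  · exact ⟨u, v, hEq, huv⟩
  subst hEq
  obtain ⟨g, hg⟩ := exists_apply_ne hΓ hne u
  obtain ⟨C, hC⟩ := hd.exists_abs_mag_mul_left_le hΓ hne hσ.coarseCocycle hσ.magnitude g
  refine ⟨(g : M ≃ₜ M) u, u, hg, fun W hW => ?_⟩
  -- Replacing `γ` by `g * γ` multiplies `γ⁻¹` by `g⁻¹` on the right, which acts trivially on `M`;
  -- so `(u, u)` goes to `(g u, u)`.
  have hcont : Continuous (Prod.map (leftMul g) (rightMul g⁻¹)) :=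
    (hd.continuous_leftMul g).prodMap (hd.continuous_rightMul g⁻¹)
  have hW' := hcont.continuousAt.preimage_mem_nhds
    (x := (ofSpace Γ u, ofSpace Γ u)) (t := W) hW
  have htop := huv _ hW'
  set H' := {γ : Γ | ((ofGroup γ, ofGroup γ⁻¹) : GroupUnion Γ × GroupUnion Γ) ∈
    Prod.map (leftMul g) (rightMul g⁻¹) ⁻¹' W} with hH'
  let f : H' → {γ : Γ | ((ofGroup γ, ofGroup γ⁻¹) : GroupUnion Γ × GroupUnion Γ) ∈ W} :=
    fun γ => ⟨g * γ, by
      have := γ.2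
      rw [mem_ofPred_eq, mul_inv_rev]
      exact this⟩
  have hf : Function.Injective f := fun γ γ' h' =>
    Subtype.ext (mul_right_injective g (congrArg Subtype.val h'))
  refine top_le_iff.1 (le_trans ?_ (ENNReal.tsum_comp_le_tsum_of_injective hf _))
  have hle : ∀ γ : H', ENNReal.ofReal (Real.exp (-s * C)) *
      ENNReal.ofReal (Real.exp (-s * mag γ)) ≤ ENNReal.ofReal (Real.exp (-s * mag (f γ))) := by
    intro γ
    rw [← ENNReal.ofReal_mul (Real.exp_pos _).le, ← Real.exp_add]
    refine ENNReal.ofReal_le_ofReal (Real.exp_le_exp.2 ?_)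
    have h1 := (abs_le.1 (hC γ)).2
    have h2 : s * mag (f γ) ≤ s * (mag γ + C) := mul_le_mul_of_nonneg_left (by
      change mag (g * γ) ≤ _
      linarith) hs
    linarith
  refine le_trans (le_of_eq ?_) (ENNReal.tsum_le_tsum hle)
  rw [ENNReal.tsum_mul_left]
  change ⊤ = _ * poincareSeries mag H' s
  rw [htop, ENNReal.mul_top (ENNReal.ofReal_pos.2 (Real.exp_pos _)).ne']

/-- A set `S` of elements that contract towards `u`, and whose inverses contract towards `v`. -/
structure IsContractingPair (ε : ℝ) (u v : M) (S : Set Γ) : Prop where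
  pos : 0 < ε
  far : 6 * ε ≤ dist (ofSpace Γ u) (ofSpace Γ v)
  far_one : 2 * ε ≤ dist (ofGroup 1) (ofSpace Γ u)
  near : ∀ s ∈ S, dist (ofGroup s) (ofSpace Γ u) < ε
  near_inv : ∀ s ∈ S, dist (ofGroup s⁻¹) (ofSpace Γ v) < ε
  contracting : ∀ s ∈ S, IsContracting ε s
  contracting_inv : ∀ s ∈ S, IsContracting ε s⁻¹

namespace IsContractingPair

variable {ε : ℝ} {u v : M} {S : Set Γ}

lemma mono (h : IsContractingPair ε u v S) {S' : Set Γ} (hS : S' ⊆ S) :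
    IsContractingPair ε u v S' :=
  ⟨h.pos, h.far, h.far_one, fun s hs => h.near s (hS hs), fun s hs => h.near_inv s (hS hs),
    fun s hs => h.contracting s (hS hs), fun s hs => h.contracting_inv s (hS hs)⟩

lemma far_of_near (h : IsContractingPair ε u v S) {z w : GroupUnion Γ}
    (hz : dist z (ofSpace Γ u) < 2 * ε) (hw : dist w (ofSpace Γ v) < 2 * ε) : 2 * ε < dist z w := by
  have := dist_triangle4 (ofSpace Γ u) z w (ofSpace Γ v)
  rw [dist_comm (ofSpace Γ u) z] at this
  linarith [h.far]

/-- Induction from the last letter: a product near `u` is far from `s⁻¹`, which is near `v`, so `s`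
sends it within `ε` of `s`, hence within `2 * ε` of `u`. -/
lemma near_prod (h : IsContractingPair ε u v S) :
    ∀ l : List Γ, (∀ g ∈ l, g ∈ S) → l ≠ [] → dist (ofGroup l.prod) (ofSpace Γ u) < 2 * ε := by
  intro l
  induction l with
  | nil => intro _ h; exact absurd rfl h
  | cons s l ih =>
    intro hl _
    have hε := h.pos
    have hs := hl s List.mem_cons_self
    have h1 := h.near s hs
    rw [List.prod_cons]
    by_cases hnil : l = []
    · subst hnil
      rw [List.prod_nil, mul_one]
      linarith
    · have h2 := ih (fun g hg => hl g (List.mem_cons_of_mem _ hg)) hnil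
      have h3 := h.far_of_near h2 (w := ofGroup s⁻¹) (by linarith [h.near_inv s hs])
      have h4 := (h.contracting s hs).group l.prod (by linarith)
      linarith [dist_triangle (ofGroup (s * l.prod)) (ofGroup s) (ofSpace Γ u)]

lemma near_prod_inv (h : IsContractingPair ε u v S) :
    ∀ l : List Γ, (∀ g ∈ l, g ∈ S) → l ≠ [] →
      dist (ofGroup l.prod⁻¹) (ofSpace Γ v) < 2 * ε := by
  intro l
  induction l using List.reverseRecOn with
  | nil => intro _ h; exact absurd rfl h
  | append_singleton l s ih =>
    intro hl _
    have hε := h.pos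
    have hs := hl s (by simp)
    have h1 := h.near_inv s hs
    rw [List.prod_append, List.prod_singleton, mul_inv_rev]
    by_cases hnil : l = []
    · subst hnil
      rw [List.prod_nil, inv_one, mul_one]
      linarith
    · have h2 := ih (fun g hg => hl g (List.mem_append_left _ hg)) hnil
      have h3 := h.far_of_near (z := ofGroup s) (by linarith [h.near s hs]) h2
      have h4 := (h.contracting_inv s hs).group l.prod⁻¹ (by
        rw [inv_inv, dist_comm]; linarith)
      linarith [dist_triangle (ofGroup (s⁻¹ * l.prod⁻¹)) (ofGroup s⁻¹) (ofSpace Γ v)]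

lemma near_apply (h : IsContractingPair ε u v S) {s : Γ} (hs : s ∈ S) {x : M}
    (hx : dist (ofSpace Γ x) (ofSpace Γ u) < 2 * ε) :
    dist (ofSpace Γ ((s : M ≃ₜ M) x)) (ofSpace Γ u) < 2 * ε := by
  have hε := h.pos
  have h3 := h.far_of_near hx (w := ofGroup s⁻¹) (by linarith [h.near_inv s hs])
  have h4 := (h.contracting s hs).space x (by linarith)
  linarith [dist_triangle (ofSpace Γ ((s : M ≃ₜ M) x)) (ofGroup s) (ofSpace Γ u), h.near s hs]

lemma near_prod_apply (h : IsContractingPair ε u v S) {x : M}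
    (hx : dist (ofSpace Γ x) (ofSpace Γ u) < 2 * ε) :
    ∀ l : List Γ, (∀ g ∈ l, g ∈ S) →
      dist (ofSpace Γ ((l.prod : M ≃ₜ M) x)) (ofSpace Γ u) < 2 * ε := by
  intro l
  induction l with
  | nil => intro _; simpa using hx
  | cons s l ih =>
    intro hl
    rw [List.prod_cons, Subgroup.coe_mul, Homeomorph.mul_apply]
    exact h.near_apply (hl s List.mem_cons_self) (ih fun g hg => hl g (List.mem_cons_of_mem _ hg))

/-- Quasi-additivity on the semigroup generated by `S`. -/
lemma abs_mag_mul_le (h : IsContractingPair ε u v S) {C : ℝ}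
    (hC : ∀ α β : Γ, ε < dist (ofGroup α⁻¹) (ofGroup β : GroupUnion Γ) →
      |mag (α * β) - mag α - mag β| ≤ C) (hC1 : |mag 1| ≤ C) (l l' : List Γ)
    (hl : ∀ g ∈ l, g ∈ S) (hl' : ∀ g ∈ l', g ∈ S) :
    |mag (l.prod * l'.prod) - mag l.prod - mag l'.prod| ≤ C := by
  by_cases h1 : l = []
  · subst h1
    simpa using hC1
  by_cases h2 : l' = []
  · subst h2
    simpa using hC1
  refine hC _ _ ?_
  rw [dist_comm]
  linarith [h.far_of_near (h.near_prod l' hl' h2) (h.near_prod_inv l hl h1), h.pos]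

/-- The ping-pong lemma. -/
lemma isFreeOn {S : Finset Γ} (h : IsContractingPair ε u v (S : Set Γ))
    (hsep : ∀ s ∈ S, ∀ s' ∈ S, s ≠ s' → ∀ x x' : M,
      dist (ofSpace Γ x) (ofSpace Γ u) < 2 * ε → dist (ofSpace Γ x') (ofSpace Γ u) < 2 * ε →
      (s : M ≃ₜ M) x ≠ (s' : M ≃ₜ M) x') : IsFreeOn S := by
  have hu : dist (ofSpace Γ u) (ofSpace Γ u) < 2 * ε := by
    rw [dist_self]; linarith [h.pos]
  -- Nonempty words stay within `2 * ε` of `u`, and `far_one` keeps the identity out of that ball.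
  have hone : ∀ l : List Γ, (∀ g ∈ l, g ∈ S) → l.prod = 1 → l = [] := by
    intro l hl h1
    by_contra hnil
    have := h.near_prod l hl hnil
    rw [h1] at this
    linarith [h.far_one]
  refine isFreeOn_iff.2 fun l => ?_
  induction l with
  | nil => intro l' _ hl' hEq; exact (hone l' hl' hEq.symm).symm
  | cons s l ih =>
    intro l' hl hl' hEq
    cases l' with
    | nil => exact hone _ hl hEq
    | cons s' l' =>
      have hls := fun g hg => hl g (List.mem_cons_of_mem s hg)
      have hls' := fun g hg => hl' g (List.mem_cons_of_mem s' hg)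
      -- Both tails keep `u` in the ball around `u`, and distinct first letters have disjoint images
      -- of this ball.
      have hss : s = s' := by
        by_contra hne
        refine hsep s (hl s List.mem_cons_self) s' (hl' s' List.mem_cons_self) hne _ _
          (h.near_prod_apply hu l hls) (h.near_prod_apply hu l' hls') ?_
        rw [List.prod_cons, List.prod_cons] at hEq
        simpa using congrArg (fun γ : Γ => (γ : M ≃ₜ M) u) hEq
      subst hss
      rw [List.prod_cons, List.prod_cons] at hEq
      rw [ih l' hls hls' (mul_left_cancel hEq)]

end IsContractingPair

open scoped Pointwise in
/-- Elements of a common shell that move two points near `u` to the same point differ by an element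
of a finite set, which does not depend on the shell. -/
lemma IsExpanding.exists_finite_separating [CompactSpace M] (hd : IsCompatible d)
    (hΓ : IsConvergenceGroup Γ) (hne : IsNonElementary Γ) (hσ : IsExpanding d σ mag)
    {ε : ℝ} (hε : 0 < ε) :
    ∃ K : Finset Γ, 1 ∈ K ∧ (∀ g ∈ K, g⁻¹ ∈ K) ∧
      ∀ (u v : M) (S : Set Γ), IsContractingPair ε u v S →
      ∀ t : ℝ, (∀ s ∈ S, t ≤ mag s ∧ mag s < t + 1) → ∀ s ∈ S, ∀ s' ∈ S, ∀ x x' : M,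
      dist (ofSpace Γ x) (ofSpace Γ u) < 2 * ε → dist (ofSpace Γ x') (ofSpace Γ u) < 2 * ε →
      (s : M ≃ₜ M) x = (s' : M ≃ₜ M) x' → s⁻¹ * s' ∈ K := by
  classical
  obtain ⟨κ, hκ⟩ := hσ.coarseCocycle
  obtain ⟨C, hC⟩ := hd.exists_abs_mag_mul_le hΓ hne hσ.coarseCocycle hσ.magnitude hε
  obtain ⟨C', -, hC'⟩ := hσ.magnitude ε hε
  set R := max (C + 1) (1 + 3 * C' + κ) + 1 with hR
  have hfin : {γ | mag γ < R}.Finite := by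
    simpa using ((hσ.tendsto_mag hd hΓ hne).eventually_ge_atTop R)
  let K := insert 1 (hfin.toFinset ∪ hfin.toFinset⁻¹)
  refine ⟨K, by simp [K], fun g hg => ?_, ?_⟩
  · simp only [K, Finset.mem_insert, Finset.mem_union, Finset.mem_inv', inv_inv, inv_eq_one] at hg ⊢
    tauto
  intro u v S hS t ht s hs s' hs' x x' hx hx' hEq
  simp only [K, Finset.mem_insert, Finset.mem_union, Finset.mem_inv', Finite.mem_toFinset,
    mem_ofPred_eq]
  right
  set g := s⁻¹ * s' with hg
  have hsg : s * g = s' := by rw [hg, mul_inv_cancel_left]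
  -- If `g` is far from `s⁻¹`, then `mag s' = mag (s * g)` is `mag s + mag g` up to `C`, and the
  -- common shell bounds `mag g`.
  by_cases hfar : ε < dist (ofGroup s⁻¹) (ofGroup g : GroupUnion Γ)
  · left
    have h1 := (abs_le.1 (hC s g hfar)).1
    rw [hsg] at h1
    have h2 := le_max_left (C + 1) (1 + 3 * C' + κ)
    linarith [(ht s hs).1, (ht s' hs').2]
  · right
    -- Here `g` is near `s⁻¹`, hence far from `x`, so `σ g⁻¹ x` computes `mag g⁻¹`. Since `s = s' *
    -- g⁻¹` and `g⁻¹ x = x'`, the cocycle relation compares it with `mag s - mag s' < 1`.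
    have hgx : ((g⁻¹ : Γ) : M ≃ₜ M) x = x' := by
      rw [hg, mul_inv_rev, inv_inv, Subgroup.coe_mul, Homeomorph.mul_apply, hEq]
      simp
    have h3 := hS.far_of_near hx (w := ofGroup s⁻¹) (by linarith [hS.near_inv s hs])
    have h3' := hS.far_of_near hx' (w := ofGroup s'⁻¹) (by linarith [hS.near_inv s' hs'])
    have h4 : ε < dist (ofSpace Γ x) (ofGroup (g⁻¹)⁻¹) := by
      rw [inv_inv]
      have := dist_triangle_right (ofSpace Γ x) (ofGroup s⁻¹) (ofGroup g)
      linarith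
    have e1 := (abs_le.1 (hC' x g⁻¹ h4)).1
    have e2 := (abs_le.1 (hC' x s (by linarith))).2
    have e3 := (abs_le.1 (hC' x' s' (by linarith))).1
    have e4 := (abs_le.1 (hκ.cocycle s' g⁻¹ x)).1
    rw [hgx, ← hsg, mul_inv_cancel_right, hsg] at e4
    have h2 := le_max_right (C + 1) (1 + 3 * C' + κ)
    linarith [(ht s hs).2, (ht s' hs').1]

end Metric

/-! ### Choice of the generating set. -/

/-- A finite set contains a `K`-separated subset of proportional size. -/
lemma exists_separated_subset {G : Type*} [Group G] (E K : Finset G) (h1 : 1 ∈ K)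
    (hinv : ∀ g ∈ K, g⁻¹ ∈ K) :
    ∃ S ⊆ E, (∀ s ∈ S, ∀ s' ∈ S, s ≠ s' → s⁻¹ * s' ∉ K) ∧ E.card ≤ S.card * K.card := by
  classical
  -- Maximality of a separated `S` forces every element of `E` into `S * K`.
  obtain ⟨S, hS⟩ := (E.powerset.filter fun S =>
    ∀ s ∈ S, ∀ s' ∈ S, s ≠ s' → s⁻¹ * s' ∉ K).exists_maximal ⟨∅, by simp⟩
  have hSm := Finset.mem_filter.1 hS.prop
  refine ⟨S, Finset.mem_powerset.1 hSm.1, hSm.2, ?_⟩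
  refine (Finset.card_le_card (t := Finset.image₂ (· * ·) S K) fun e he => ?_).trans
    (Finset.card_image₂_le _ _ _)
  rw [Finset.mem_image₂]
  by_contra! hcon
  have heS : e ∉ S := fun h => hcon e h 1 h1 (mul_one e)
  have hfar : ∀ s ∈ S, s⁻¹ * e ∉ K := fun s hs h => hcon s hs _ h (mul_inv_cancel_left s e)
  have hins : insert e S ∈ E.powerset.filter fun S =>
      ∀ s ∈ S, ∀ s' ∈ S, s ≠ s' → s⁻¹ * s' ∉ K := by
    refine Finset.mem_filter.2 ⟨Finset.mem_powerset.2
      (Finset.insert_subset he (Finset.mem_powerset.1 hSm.1)), ?_⟩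
    intro s hs s' hs' hne
    rcases Finset.mem_insert.1 hs with rfl | hs <;> rcases Finset.mem_insert.1 hs' with rfl | hs'
    · exact absurd rfl hne
    · intro h
      have := hinv _ h
      rw [mul_inv_rev, inv_inv] at this
      exact hfar s' hs' this
    · exact hfar s ‹_›
    · exact hSm.2 s hs s' hs' hne
  exact heS (hS.le_of_ge hins (Finset.subset_insert e S) (Finset.mem_insert_self e S))

/-- Bounds on words from quasi-additivity and bounds on the letters. -/
lemma mag_prod_bounds {G : Type*} [Group G] {S : Finset G} {mag : G → ℝ} {C t : ℝ}
    (hC : ∀ l l' : List G, (∀ g ∈ l, g ∈ S) → (∀ g ∈ l', g ∈ S) →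
      |mag (l.prod * l'.prod) - mag l.prod - mag l'.prod| ≤ C)
    (hS : ∀ s ∈ S, t ≤ mag s ∧ mag s < t + 1) :
    ∀ l : List G, (∀ g ∈ l, g ∈ S) → (t - C) * l.length - |mag 1| ≤ mag l.prod ∧
      mag l.prod ≤ (t + 1 + C) * l.length + |mag 1| := by
  intro l
  induction l with
  | nil => intro _; simpa using abs_le.1 le_rfl
  | cons g l ih =>
    intro hl
    have hls := fun g' hg' => hl g' (List.mem_cons_of_mem g hg')
    obtain ⟨h1, h2⟩ := ih hls
    have h3 := abs_le.1 (hC [g] l (by simpa using hl g List.mem_cons_self) hls)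
    have h4 := hS g (hl g List.mem_cons_self)
    rw [List.prod_singleton] at h3
    rw [List.prod_cons, List.length_cons]
    push_cast
    constructor <;> linarith [h3.1, h3.2, h4.1, h4.2]

lemma log_natCeil_exp_bounds {X : ℝ} (hX : 0 ≤ X) :
    X ≤ Real.log (⌈Real.exp X⌉₊ : ℝ) ∧ Real.log (⌈Real.exp X⌉₊ : ℝ) ≤ X + 1 ∧
      (⌈Real.exp X⌉₊ : ℝ) ≤ Real.exp (X + 1) := by
  have h0 : Real.exp X ≤ (⌈Real.exp X⌉₊ : ℝ) := Nat.le_ceil _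
  have hpos : (0 : ℝ) < (⌈Real.exp X⌉₊ : ℝ) := (Real.exp_pos X).trans_le h0
  have h1 : (⌈Real.exp X⌉₊ : ℝ) ≤ Real.exp (X + 1) := by
    have h2 := (Nat.ceil_lt_add_one (Real.exp_pos X).le).le
    have h3 : 1 ≤ Real.exp X := Real.one_le_exp hX
    have h4 : 2 ≤ Real.exp 1 := by linarith [Real.add_one_le_exp (1 : ℝ)]
    rw [Real.exp_add]
    nlinarith
  refine ⟨(Real.le_log_iff_exp_le hpos).2 h0, (Real.log_le_iff_le_exp hpos).2 h1, h1⟩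

/-- Free semigroups, generated by contracting elements, whose critical exponent is prescribed up to
a small error. -/
lemma IsExpanding.exists_contracting_free [d : MetricSpace (GroupUnion Γ)] [CompactSpace M]
    {σ : Γ → M → ℝ} {mag : Γ → ℝ} (hd : IsCompatible d)
    (hΓ : IsConvergenceGroup Γ) (hne : IsNonElementary Γ) (hσ : IsExpanding d σ mag)
    {δ δ' : ℝ} (hδ : 0 < δ) (hδ' : δ < δ') (htop : poincareSeries mag univ δ' = ⊤) :
    ∃ (S : Finset Γ) (ε : ℝ) (u v : M), IsContractingPair ε u v (S : Set Γ) ∧ IsFreeOn S ∧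
      ENNReal.ofReal δ ≤ criticalExponent mag (Submonoid.closure (S : Set Γ) : Set Γ) ∧
      criticalExponent mag (Submonoid.closure (S : Set Γ) : Set Γ) ≤ ENNReal.ofReal δ' := by
  have hδ'0 : 0 < δ' := hδ.trans hδ'
  have hmag := hσ.tendsto_mag hd hΓ hne
  obtain ⟨u, v, huv, hloc⟩ := hσ.exists_localized_ne hd hΓ hne hδ'0.le htop
  obtain ⟨ε, hε, hε1, hε2⟩ : ∃ ε > 0, 6 * ε ≤ dist (ofSpace Γ u) (ofSpace Γ v) ∧
      2 * ε ≤ dist (ofGroup 1) (ofSpace Γ u) := by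
    have h1 : 0 < dist (ofSpace Γ u) (ofSpace Γ v) :=
      dist_pos.2 fun h => huv (ofSpace_injective Γ h)
    have h2 : 0 < dist (ofGroup 1) (ofSpace Γ u) := dist_pos.2 (ofSpace_ne_ofGroup u 1).symm
    refine ⟨min (dist (ofSpace Γ u) (ofSpace Γ v) / 6) (dist (ofGroup 1) (ofSpace Γ u) / 2),
      lt_min (by positivity) (by positivity), ?_, ?_⟩
    · linarith [min_le_left (dist (ofSpace Γ u) (ofSpace Γ v) / 6)
        (dist (ofGroup 1) (ofSpace Γ u) / 2)]
    · linarith [min_le_right (dist (ofSpace Γ u) (ofSpace Γ v) / 6)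
        (dist (ofGroup 1) (ofSpace Γ u) / 2)]
  obtain ⟨C₀, hC₀⟩ := hd.exists_abs_mag_mul_le hΓ hne hσ.coarseCocycle hσ.magnitude hε
  set C := max C₀ |mag 1| with hCdef
  have hC : ∀ α β : Γ, ε < dist (ofGroup α⁻¹) (ofGroup β : GroupUnion Γ) →
      |mag (α * β) - mag α - mag β| ≤ C := fun α β h => (hC₀ α β h).trans (le_max_left _ _)
  have hC1 : |mag 1| ≤ C := le_max_right _ _
  have hC0 : 0 ≤ C := (abs_nonneg _).trans hC1
  obtain ⟨K, hK1, hKinv, hK⟩ := hσ.exists_finite_separating hd hΓ hne hε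
  have hKpos : (0 : ℝ) < K.card := by exact_mod_cast Finset.card_pos.2 ⟨1, hK1⟩
  -- the contracting elements near `(u, v)`
  set H : Set Γ := {γ | dist (ofGroup γ) (ofSpace Γ u) < ε ∧ dist (ofGroup γ⁻¹) (ofSpace Γ v) < ε ∧
    IsContracting ε γ ∧ IsContracting ε γ⁻¹} with hH
  have hpair : IsContractingPair ε u v H := ⟨hε, hε1, hε2, fun s hs => hs.1, fun s hs => hs.2.1,
    fun s hs => hs.2.2.1, fun s hs => hs.2.2.2⟩
  have hev := hd.eventually_contracting hΓ hne hε
  have hfin : {γ : Γ | ¬ (IsContracting ε γ ∧ IsContracting ε γ⁻¹)}.Finite :=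
    hev.and (inv_injective.tendsto_cofinite.eventually hev)
  have hHtop : poincareSeries mag H δ' = ⊤ := by
    have h1 := hloc _ (prod_mem_nhds (Metric.ball_mem_nhds (ofSpace Γ u) hε)
      (Metric.ball_mem_nhds (ofSpace Γ v) hε))
    have hsub : {γ : Γ | (ofGroup γ, ofGroup γ⁻¹) ∈
        Metric.ball (ofSpace Γ u) ε ×ˢ Metric.ball (ofSpace Γ v) ε} ⊆
        H ∪ {γ : Γ | ¬ (IsContracting ε γ ∧ IsContracting ε γ⁻¹)} := by
      intro γ hγ
      by_cases h : IsContracting ε γ ∧ IsContracting ε γ⁻¹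
      · exact Or.inl ⟨hγ.1, hγ.2, h⟩
      · exact Or.inr h
    have h2 := (poincareSeries_mono (mag := mag) (s := δ') hsub).trans
      (poincareSeries_union_le _ _)
    rw [h1, top_le_iff, ENNReal.add_eq_top] at h2
    exact h2.resolve_right (poincareSeries_lt_top_of_finite hfin).ne
  -- a large shell
  set η := (δ' - δ) / 2 with hη
  have hη0 : 0 < η := by rw [hη]; linarith
  -- The three lower bounds ensure, in order, that `n - C` is positive, that the shell divided by
  -- `#K` still has `⌈e^X⌉` elements, and that `(X + 1) / (n - C) ≤ δ'`, where `X = δ * (n + 1 +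
  -- C)`.
  obtain ⟨N, hN⟩ := exists_nat_gt (max (C + 1)
    (max ((Real.log K.card + δ * (1 + C) + 1) / η) ((δ * (1 + C) + 1 + δ' * C) / (δ' - δ))))
  obtain ⟨n, hn, hshell⟩ := exists_large_shell hmag hδ'0.le
    (show δ + η < δ' by rw [hη]; linarith) hHtop N
  have hnN : max (C + 1)
    (max ((Real.log K.card + δ * (1 + C) + 1) / η) ((δ * (1 + C) + 1 + δ' * C) / (δ' - δ))) < n :=
    hN.trans_le (by exact_mod_cast hn)
  rw [max_lt_iff, max_lt_iff, div_lt_iff₀ hη0, div_lt_iff₀ (by linarith)] at hnN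
  obtain ⟨hn1, hn2, hn3⟩ := hnN
  have hEfin : {γ ∈ H | (n : ℝ) ≤ mag γ ∧ mag γ < n + 1}.Finite := by
    have : {γ | mag γ < n + 1}.Finite := by simpa using (hmag.eventually_ge_atTop (n + 1 : ℝ))
    exact this.subset fun γ hγ => hγ.2.2
  rw [ncard_eq_toFinset_card _ hEfin] at hshell
  obtain ⟨S₀, hS₀E, hS₀sep, hS₀card⟩ := exists_separated_subset hEfin.toFinset K hK1 hKinv
  set X := δ * (n + 1 + C) with hX
  have hX0 : 0 ≤ X := by positivity
  obtain ⟨hlog1, hlog2, hceil⟩ := log_natCeil_exp_bounds hX0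
  have hcard : ⌈Real.exp X⌉₊ ≤ S₀.card := by
    have h1 : Real.exp ((δ + η) * n) ≤ S₀.card * K.card :=
      hshell.trans (by exact_mod_cast hS₀card)
    have h2 : Real.exp (X + 1) * K.card ≤ Real.exp ((δ + η) * n) := by
      rw [← Real.exp_log hKpos, ← Real.exp_add]
      exact Real.exp_le_exp.2 (by rw [hX]; linarith)
    have h3 := le_of_mul_le_mul_right (h2.trans h1) hKpos
    exact_mod_cast hceil.trans h3
  -- Trimming to exactly `⌈e^X⌉` elements keeps the exponent at most `δ'`; the choice of `X` makes
  -- `log(#S) / (n + 1 + C)` at least `δ`.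
  obtain ⟨S, hSS₀, hScard⟩ := Finset.exists_subset_card_eq hcard
  have hSE : ∀ s ∈ S, s ∈ H ∧ (n : ℝ) ≤ mag s ∧ mag s < n + 1 := fun s hs =>
    hEfin.mem_toFinset.1 (hS₀E (hSS₀ hs))
  have hSpair : IsContractingPair ε u v (S : Set Γ) := hpair.mono fun s hs => (hSE s hs).1
  have hfree : IsFreeOn S := by
    refine hSpair.isFreeOn fun s hs s' hs' hss x x' hx hx' hEq => ?_
    exact hS₀sep s (hSS₀ hs) s' (hSS₀ hs') hss
      (hK u v S hSpair n (fun s hs => (hSE s hs).2) s hs s' hs' x x' hx hx' hEq)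
  have hqa := hSpair.abs_mag_mul_le hC hC1
  have hwords := mag_prod_bounds hqa fun s hs => (hSE s hs).2
  have hA : (0 : ℝ) < n - C := by linarith
  have hA' : (0 : ℝ) < n + 1 + C := by linarith
  refine ⟨S, ε, u, v, hSpair, hfree, ?_, ?_⟩
  · refine le_trans (ENNReal.ofReal_le_ofReal ?_)
      (hfree.le_criticalExponent_of_words hA' fun l hl => (hwords l hl).2)
    rw [hScard, le_div_iff₀ hA']
    exact hlog1
  · refine (criticalExponent_le_of_words hA fun l hl => (hwords l hl).1).trans
      (ENNReal.ofReal_le_ofReal ?_)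
    rw [hScard, div_le_iff₀ hA]
    refine hlog2.trans ?_
    rw [hX]
    linarith

end BishopJones

/-! ### Assembly of the five properties. -/

theorem theorem3p1 {M : Type*} [MetricSpace M] [CompactSpace M]
    (Γ : Subgroup (M ≃ₜ M)) (hΓ : BishopJones.IsConvergenceGroup Γ)
    (hne : BishopJones.IsNonElementary Γ)
    (d : MetricSpace (BishopJones.GroupUnion Γ)) (hd : BishopJones.IsCompatible d)
    (σ : Γ → M → ℝ) (magσ : Γ → ℝ) (hσ : BishopJones.IsExpanding d σ magσ)
    (δ : ℝ) (hδ : 0 < δ)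
    (hδσ : ENNReal.ofReal δ < BishopJones.criticalExponent magσ (Set.univ : Set Γ)) :
    ∃ (S : Finset Γ) (T : Submonoid Γ),
      T = Submonoid.closure (S : Set Γ) ∧
      BishopJones.IsFreeOn S ∧
      -- (1)
      ENNReal.ofReal δ ≤ BishopJones.criticalExponent magσ (T : Set Γ) ∧
      -- (2)
      (∀ (φ : Γ → M → ℝ) (magφ : Γ → ℝ), BishopJones.IsExpanding d φ magφ →
        ∃ B₁ b₁ : ℝ, 1 < B₁ ∧ 0 < b₁ ∧
          BishopJones.CoarselyBiLipschitzOn (T : Set Γ) B₁ b₁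
            (fun γ => (BishopJones.wordLength S γ : ℝ)) magφ) ∧
      -- (3): every pair of constants that is as in (2) for `σ` will do
      (∀ B₁ b₁ : ℝ, 1 < B₁ → 0 < b₁ →
        BishopJones.CoarselyBiLipschitzOn (T : Set Γ) B₁ b₁
          (fun γ => (BishopJones.wordLength S γ : ℝ)) magσ →
        ENNReal.ofReal (1 / B₁ * Real.log (S.card : ℝ)) ≤
            BishopJones.criticalExponent magσ (T : Set Γ) ∧
          BishopJones.criticalExponent magσ (T : Set Γ) ≤
            ENNReal.ofReal (B₁ * Real.log (S.card : ℝ))) ∧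
      BishopJones.criticalExponent magσ (T : Set Γ) < ⊤ ∧
      -- (4)
      BishopJones.criticalExponent magσ (T : Set Γ) <
        BishopJones.criticalExponent magσ (Set.univ : Set Γ) ∧
      -- (5)
      (∀ (φ₁ φ₂ : Γ → M → ℝ) (mag₁ mag₂ : Γ → ℝ),
        BishopJones.IsExpanding d φ₁ mag₁ → BishopJones.IsExpanding d φ₂ mag₂ →
        ∃ B₂ b₂ : ℝ, 1 < B₂ ∧ 0 < b₂ ∧
          BishopJones.CoarselyBiLipschitzOn (T : Set Γ) B₂ b₂ mag₂ mag₁) := by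
  -- The gap between `δ'` and the exponent of `Γ` yields the strict inequality (4); `δ'` is real
  -- even if that exponent is infinite.
  obtain ⟨δ', hδ'0, hδδ', hδ'σ⟩ := ENNReal.lt_iff_exists_real_btwn.1 hδσ
  rw [ENNReal.ofReal_lt_ofReal_iff_of_nonneg hδ.le] at hδδ'
  have htop := BishopJones.poincareSeries_eq_top_of_lt (hδ.trans hδδ') hδ'σ
  obtain ⟨S, ε, u, v, hpair, hfree, hlow, hup⟩ :=
    hσ.exists_contracting_free hd hΓ hne hδ hδδ' htop
  have h2 : ∀ (φ : Γ → M → ℝ) (magφ : Γ → ℝ), BishopJones.IsExpanding d φ magφ →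
      ∃ B₁ b₁ : ℝ, 1 < B₁ ∧ 0 < b₁ ∧
        BishopJones.CoarselyBiLipschitzOn (Submonoid.closure (S : Set Γ) : Set Γ) B₁ b₁
          (fun γ => (BishopJones.wordLength S γ : ℝ)) magφ := by
    intro φ magφ hφ
    obtain ⟨C, hC⟩ := hd.exists_abs_mag_mul_le hΓ hne hφ.coarseCocycle hφ.magnitude hpair.pos
    exact hfree.coarselyBiLipschitzOn_wordLength (hφ.tendsto_mag hd hΓ hne)
      (hpair.abs_mag_mul_le (fun α β h => (hC α β h).trans (le_max_left C |magφ 1|))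
        (le_max_right _ _))
  refine ⟨S, _, rfl, hfree, hlow, h2, ?_, hup.trans_lt ENNReal.ofReal_lt_top,
    hup.trans_lt hδ'σ, ?_⟩
  · intro B b hB hb h
    have hB0 : 0 < B := one_pos.trans hB
    constructor
    · rw [one_div_mul_eq_div]
      refine hfree.le_criticalExponent_of_words hB0 (A₀ := b) fun l hl => ?_
      have := (h l.prod (BishopJones.mem_closure_iff_exists_list.2 ⟨l, hl, rfl⟩)).2
      beta_reduce at this
      rwa [hfree.wordLength_prod hl] at this
    · have : B * Real.log S.card = Real.log S.card / (1 / B) := by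
        rw [div_div_eq_mul_div, div_one, mul_comm]
      rw [this]
      refine BishopJones.criticalExponent_le_of_words (one_div_pos.2 hB0) (A₀ := b) fun l hl => ?_
      have := (h l.prod (BishopJones.mem_closure_iff_exists_list.2 ⟨l, hl, rfl⟩)).1
      beta_reduce at this
      rwa [hfree.wordLength_prod hl] at this
  · intro φ₁ φ₂ mag₁ mag₂ h₁ h₂
    obtain ⟨B, b, hB, hb, h⟩ := h2 φ₁ mag₁ h₁
    obtain ⟨B', b', hB', hb', h'⟩ := h2 φ₂ mag₂ h₂
    exact h.trans hB hb hB' hb' h'
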